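/- For a set $S$, let $[S]^2$ denote the set of all unordered pairs of distinct elements of $S$. For an infinite set $F\subseteq\mathbb N=\{0,1,2,\dots\}$ put $$FS(F)=\Big\{\sum_{n\in\alpha}n:\ \alpha\subseteq F \text{ finite and non-empty}\Big\},\qquad r(F)=[F]^2,\qquad \Delta(F)=\{a-b:\ a,b\in F,\ a>b\}.$$ Let $\rho$ be one of $FS$, $r$, $\Delta$, and let $\Lambda=\mathbb N$, $[\mathbb N]^2$, $\mathbb N$, respectively. A topological space $X$ belongs to $\mathrm{FinBW}(\rho)$ if for every $f:\Lambda\to X$ there are an infinite set $F\subseteq\mathbb N$ and a point $x\in X$ such that for every neighbourhood $U$ of $x$ there is a finite set $K\subseteq\mathbb N$ with $f[\rho(F\setminus K)]\subseteq U$. The space $X$ is called a Hindman space if $X\in\mathrm{FinBW}(FS)$, a Ramsey space if $X\in\mathrm{FinBW}(r)$, and differentially compact if $X\in\mathrm{FinBW}(\Delta)$. An almost disjoint family on $\mathbb N$ is a family $\mathcal A$ of infinite subsets of $\mathbb N$ such that $A\cap B$ is finite for all distinct $A,B\in\mathcal A$. Let $\Psi(\mathcal A)$ be the disjoint union of $\mathbb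 N$ and $\mathcal A$ with the topology in which the points of $\mathbb N$ are isolated and the basic neighbourhoods of $A\in\mathcal A$ are the sets $\{A\}\cup(A\setminus F)$ with $F$ finite, and let $\Phi(\mathcal A)=\Psi(\mathcal A)\cup\{\infty\}$ be the Alexandroff one-point compactification of $\Psi(\mathcal A)$. Assume the continuum hypothesis. Then, for each of the following four items, there exists an almost disjoint family $\mathcal A$ on $\mathbb N$ (in general a different one for each item) such that $\Phi(\mathcal A)$ is a Hausdorff, compact and separable space of cardinality $\mathfrak c$ and: 1. $\Phi(\mathcal A)$ is a Ramsey space that is not a Hindman space; 2. $\Phi(\mathcal A)$ is a Hindman space that is not a Ramsey space; 3. $\Phi(\mathcal A)$ is a differentially compact space that is not a Hindman space; 4. $\Phi(\mathcal A)$ is a differentially compact space that is not a Ramsey space. -/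

import Mathlib

open Topology Cardinal

/-! ## Convergence along `ρ` and the class `FinBW(ρ)` -/

section FinBW

/-- `[ℕ]²`: the set of unordered pairs of (distinct) natural numbers. -/
abbrev NatPair : Type := {p : Finset ℕ // p.card = 2}

/-- `FS(D)`: the set of all sums of finite non-empty sets of (distinct) elements of `D`. -/
def finiteSums (D : Set ℕ) : Set ℕ :=
  {n | ∃ α : Finset ℕ, α.Nonempty ∧ (α : Set ℕ) ⊆ D ∧ n = ∑ i ∈ α, i}

/-- `r(H) = [H]²`: the set of all unordered pairs of elements of `H`. -/
def pairsOf (H : Set ℕ) : Set NatPair :=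
  {p | (p.1 : Set ℕ) ⊆ H}

/-- `Δ(E)`: the set of all positive differences of elements of `E`. -/
def positiveDifferences (E : Set ℕ) : Set ℕ :=
  {d | ∃ a ∈ E, ∃ b ∈ E, b < a ∧ d = a - b}

/-- The restriction of `f` to `ρ(F)` is `ρ`-convergent to `x`: for every neighbourhood `U` of `x`
there is a finite set `K` such that `f` maps `ρ(F \ K)` into `U`. -/
def RhoConverges {Λ X : Type*} [TopologicalSpace X] (ρ : Set ℕ → Set Λ) (F : Set ℕ)
    (f : Λ → X) (x : X) : Prop :=
  ∀ U ∈ 𝓝 x, ∃ K : Finset ℕ, f '' ρ (F \ (K : Set ℕ)) ⊆ U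

/-- `X` belongs to `FinBW(ρ)`, where `ρ` is defined on the infinite subsets of `ℕ`: for every
`f : Λ → X` there is an infinite `F ⊆ ℕ` such that the restriction of `f` to `ρ(F)` is
`ρ`-convergent to some point of `X`. -/
def FinBW {Λ : Type*} (ρ : Set ℕ → Set Λ) (X : Type*) [TopologicalSpace X] : Prop :=
  ∀ f : Λ → X, ∃ F : Set ℕ, F.Infinite ∧ ∃ x : X, RhoConverges ρ F f x

/-- Hindman spaces. -/
def IsHindmanSpace (X : Type*) [TopologicalSpace X] : Prop :=
  FinBW finiteSums X

/-- Ramsey spaces. -/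
def IsRamseySpace (X : Type*) [TopologicalSpace X] : Prop :=
  FinBW pairsOf X

/-- Differentially compact spaces. -/
def IsDifferentiallyCompact (X : Type*) [TopologicalSpace X] : Prop :=
  FinBW positiveDifferences X

end FinBW

/-! ## Almost disjoint families and the spaces `Ψ(𝒜)` and `Φ(𝒜)` -/

section Mrowka

/-- `𝒜` is an almost disjoint family on `ℕ`: its members are infinite, and any two distinct
members have finite intersection. -/
def IsAlmostDisjointFamily (𝒜 : Set (Set ℕ)) : Prop :=
  (∀ A ∈ 𝒜, A.Infinite) ∧ ∀ A ∈ 𝒜, ∀ B ∈ 𝒜, A ≠ B → (A ∩ B).Finite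

/-- The underlying set `ℕ ⊔ 𝒜` of the Mrówka space `Ψ(𝒜)`. -/
def Psi (𝒜 : Set (Set ℕ)) : Type := ℕ ⊕ 𝒜

/-- The point of `Ψ(𝒜)` given by a natural number. -/
def Psi.ofNat {𝒜 : Set (Set ℕ)} (n : ℕ) : Psi 𝒜 := Sum.inl n

/-- The point of `Ψ(𝒜)` given by a member of the family. -/
def Psi.ofMem {𝒜 : Set (Set ℕ)} (A : 𝒜) : Psi 𝒜 := Sum.inr A

/-- The topology of `Ψ(𝒜)`: the points of `ℕ` are isolated, and the basic neighbourhoods of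
`A ∈ 𝒜` are the sets `{A} ∪ (A \ F)` with `F` finite. So `U` is open iff, for every `A ∈ 𝒜` that
is a point of `U`, all but finitely many elements of `A` are points of `U`. -/
instance Psi.instTopologicalSpace (𝒜 : Set (Set ℕ)) : TopologicalSpace (Psi 𝒜) where
  IsOpen U := ∀ A : 𝒜, Psi.ofMem A ∈ U →
    ∃ F : Finset ℕ, ∀ n ∈ (A : Set ℕ) \ (F : Set ℕ), (Psi.ofNat n : Psi 𝒜) ∈ U
  isOpen_univ := fun _ _ => ⟨∅, fun _ _ => trivial⟩
  isOpen_inter := by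
    intro U V hU hV A hA
    obtain ⟨F, hF⟩ := hU A hA.1
    obtain ⟨G, hG⟩ := hV A hA.2
    refine ⟨F ∪ G, fun n hn => ⟨hF n ⟨hn.1, fun h => hn.2 ?_⟩, hG n ⟨hn.1, fun h => hn.2 ?_⟩⟩⟩
    · exact Finset.mem_coe.2 (Finset.mem_union_left _ (Finset.mem_coe.1 h))
    · exact Finset.mem_coe.2 (Finset.mem_union_right _ (Finset.mem_coe.1 h))
  isOpen_sUnion := by
    intro S hS A hA
    obtain ⟨U, hU, hAU⟩ := hA
    obtain ⟨F, hF⟩ := hS U hU A hAU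
    exact ⟨F, fun n hn => ⟨U, hU, hF n hn⟩⟩

/-- `Φ(𝒜)`: the Alexandroff one-point compactification of `Ψ(𝒜)`. -/
abbrev Phi (𝒜 : Set (Set ℕ)) : Type := OnePoint (Psi 𝒜)

/-- `𝒜` is an almost disjoint family for which `Φ(𝒜)` is a Hausdorff, compact and separable space
of cardinality `𝔠`. -/
structure IsGoodFamily (𝒜 : Set (Set ℕ)) : Prop where
  almostDisjoint : IsAlmostDisjointFamily 𝒜
  hausdorff : T2Space (Phi 𝒜)
  compact : CompactSpace (Phi 𝒜)
  separable : TopologicalSpace.SeparableSpace (Phi 𝒜)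
  card : #(Phi 𝒜) = 𝔠

end Mrowka

/-! ## Topology of `Ψ(𝒜)` and `Φ(𝒜)` -/

section PsiTopology

variable {𝒜 : Set (Set ℕ)}

/-! Hindman spaces and Ramsey spaces are differentially compact, so items 3 and 4 follow from items
1 and 2. Those are two instances of `exists_isGoodFamily`, which rests on one combinatorial fact:
every `g : Λ → ℕ` admits an infinite `F` such that `g '' ρ₁ F` contains no `ρ₂ E` with `E` infinite.

Under CH, functions and infinite sets are listed in a well-order with countable initial segments. At
each stage a set `A` is added that contains no `ρ₂ E`, is almost disjoint from all earlier members
and from the images `g '' ρ₁ F` chosen for earlier functions, and meets every tail of `ρ₂` of the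
current infinite set. The inclusion of `ℕ` then has no `ρ₂`-convergent restriction. For `FinBW ρ₁`,
only countably many members have infinite trace on `g '' ρ₁ F`. Pushing forward an ultrafilter that
concentrates on `ρ₁ F` and has `ρ₁`-pseudointersections for countable families yields a limit, by
compactness. Even convergence to `∞` then amounts to countably many conditions.

Such ultrafilters are `U ⊗ U` for pairs and additive idempotents for finite sums. The fact itself is
proved by weak canonical Ramsey arguments along `U`: `exists_rhoSmall_finiteSums_image_pairsOf`
compares lowest and highest binary digits, and `exists_rhoSmall_pairsOf_image_finiteSums` compares
least and greatest summands. -/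

theorem Psi.isOpen_iff {U : Set (Psi 𝒜)} : IsOpen U ↔ ∀ A : 𝒜, Psi.ofMem A ∈ U →
    ∃ F : Finset ℕ, ∀ n ∈ (A : Set ℕ) \ (F : Set ℕ), (Psi.ofNat n : Psi 𝒜) ∈ U :=
  Iff.rfl

theorem Psi.cases_on (x : Psi 𝒜) : (∃ n, x = Psi.ofNat n) ∨ ∃ A, x = Psi.ofMem A := by
  rcases x with n | A
  · exact Or.inl ⟨n, rfl⟩
  · exact Or.inr ⟨A, rfl⟩

theorem Psi.ofNat_injective : Function.Injective (Psi.ofNat : ℕ → Psi 𝒜) := Sum.inl_injective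

theorem Psi.ofMem_injective : Function.Injective (Psi.ofMem : 𝒜 → Psi 𝒜) := Sum.inr_injective

theorem Psi.ofNat_ne_ofMem (n : ℕ) (A : 𝒜) : (Psi.ofNat n : Psi 𝒜) ≠ Psi.ofMem A := Sum.inl_ne_inr

/-- The basic neighbourhood `{A} ∪ (A \ F)` of `A ∈ 𝒜`. -/
def Psi.basicNhd (A : 𝒜) (F : Set ℕ) : Set (Psi 𝒜) :=
  {Psi.ofMem A} ∪ Psi.ofNat '' ((A : Set ℕ) \ F)

theorem Psi.ofNat_mem_basicNhd {A : 𝒜} {F : Set ℕ} {n : ℕ} :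
    (Psi.ofNat n : Psi 𝒜) ∈ Psi.basicNhd A F ↔ n ∈ (A : Set ℕ) \ F := by
  simp [Psi.basicNhd, Psi.ofNat_ne_ofMem, Psi.ofNat_injective.eq_iff]

theorem Psi.ofMem_mem_basicNhd {A B : 𝒜} {F : Set ℕ} :
    (Psi.ofMem B : Psi 𝒜) ∈ Psi.basicNhd A F ↔ B = A := by
  simp [Psi.basicNhd, Psi.ofNat_ne_ofMem, Psi.ofMem_injective.eq_iff]

theorem Psi.isOpen_basicNhd (A : 𝒜) (F : Finset ℕ) : IsOpen (Psi.basicNhd A (F : Set ℕ)) := by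
  rw [Psi.isOpen_iff]
  intro B hB
  rw [Psi.ofMem_mem_basicNhd] at hB
  subst hB
  exact ⟨F, fun n hn => Psi.ofNat_mem_basicNhd.2 hn⟩

theorem Psi.isOpen_singleton_ofNat (n : ℕ) : IsOpen ({Psi.ofNat n} : Set (Psi 𝒜)) := by
  rw [Psi.isOpen_iff]
  intro B hB
  exact absurd hB.symm (Psi.ofNat_ne_ofMem n B)

theorem Psi.exists_basicNhd_subset {A : 𝒜} {U : Set (Psi 𝒜)} (hU : U ∈ 𝓝 (Psi.ofMem A)) :
    ∃ F : Finset ℕ, Psi.basicNhd A (F : Set ℕ) ⊆ U := by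
  obtain ⟨V, hVU, hV, hA⟩ := mem_nhds_iff.1 hU
  obtain ⟨F, hF⟩ := Psi.isOpen_iff.1 hV A hA
  refine ⟨F, fun x hx => hVU ?_⟩
  rcases hx with rfl | ⟨n, hn, rfl⟩
  · exact hA
  · exact hF n hn

theorem Psi.isClosed_basicNhd (h𝒜 : IsAlmostDisjointFamily 𝒜) (A : 𝒜) (F : Set ℕ) :
    IsClosed (Psi.basicNhd A F) := by
  rw [← isOpen_compl_iff, Psi.isOpen_iff]
  intro B hB
  have hBA : (B : Set ℕ) ≠ A := fun h => hB (Psi.ofMem_mem_basicNhd.2 (Subtype.ext h))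
  have hfin := h𝒜.2 B B.2 A A.2 hBA
  refine ⟨hfin.toFinset, fun n hn hn' => hn.2 ?_⟩
  rw [Psi.ofNat_mem_basicNhd] at hn'
  simpa using ⟨hn.1, hn'.1⟩

/-- An ultrafilter on the set that does not converge to `A` omits a smaller basic neighbourhood, so
it lives on a finite set. -/
theorem Psi.isCompact_basicNhd (A : 𝒜) (F : Set ℕ) : IsCompact (Psi.basicNhd A F) := by
  rw [isCompact_iff_ultrafilter_le_nhds]
  intro f hf
  by_cases h : ↑f ≤ 𝓝 (Psi.ofMem A : Psi 𝒜)
  · exact ⟨_, Psi.ofMem_mem_basicNhd.2 rfl, h⟩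
  · obtain ⟨U, hU, hUf⟩ := Filter.not_le.1 h
    obtain ⟨G, hG⟩ := Psi.exists_basicNhd_subset hU
    have hs : (Psi.ofNat '' ((A : Set ℕ) \ F ∩ G) : Set (Psi 𝒜)) ∈ f := by
      filter_upwards [Filter.le_principal_iff.1 hf, Ultrafilter.compl_mem_iff_notMem.2 hUf]
        with x hx hxU
      rcases hx with rfl | ⟨n, hn, rfl⟩
      · exact absurd (hG (Psi.ofMem_mem_basicNhd.2 rfl)) hxU
      · refine ⟨n, ⟨hn, ?_⟩, rfl⟩
        by_contra hnG
        exact hxU (hG (Psi.ofNat_mem_basicNhd.2 ⟨hn.1, hnG⟩))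
    have hfin : (Psi.ofNat '' ((A : Set ℕ) \ F ∩ G) : Set (Psi 𝒜)).Finite :=
      (G.finite_toSet.subset Set.inter_subset_right).image _
    obtain ⟨x, hx, hfx⟩ := isCompact_iff_ultrafilter_le_nhds.1 hfin.isCompact f
      (Filter.le_principal_iff.2 hs)
    obtain ⟨n, hn, rfl⟩ := hx
    exact ⟨_, Psi.ofNat_mem_basicNhd.2 hn.1, hfx⟩

theorem Psi.isClosed_singleton_ofNat (n : ℕ) : IsClosed ({Psi.ofNat n} : Set (Psi 𝒜)) := by
  rw [← isOpen_compl_iff, Psi.isOpen_iff]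
  intro B _
  refine ⟨{n}, fun m hm h => hm.2 ?_⟩
  simpa using Psi.ofNat_injective h

theorem Psi.t2Space (h𝒜 : IsAlmostDisjointFamily 𝒜) : T2Space (Psi 𝒜) := by
  have key : ∀ x y : Psi 𝒜, x ≠ y → ∃ U : Set (Psi 𝒜), IsClopen U ∧ x ∈ U ∧ y ∉ U := by
    intro x y hxy
    rcases Psi.cases_on x with ⟨n, rfl⟩ | ⟨A, rfl⟩
    · exact ⟨_, ⟨Psi.isClosed_singleton_ofNat n, Psi.isOpen_singleton_ofNat n⟩, rfl, hxy.symm⟩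
    rcases Psi.cases_on y with ⟨n, rfl⟩ | ⟨B, rfl⟩
    · exact ⟨_, ⟨(Psi.isOpen_singleton_ofNat n).isClosed_compl,
        (Psi.isClosed_singleton_ofNat n).isOpen_compl⟩, hxy, fun h => h rfl⟩
    · refine ⟨_, ⟨Psi.isClosed_basicNhd h𝒜 A (∅ : Finset ℕ), Psi.isOpen_basicNhd A ∅⟩,
        Psi.ofMem_mem_basicNhd.2 rfl, fun h => hxy ?_⟩
      rw [Psi.ofMem_mem_basicNhd.1 h]
  refine ⟨fun x y hxy => ?_⟩
  obtain ⟨U, hU, hx, hy⟩ := key x y hxy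
  exact ⟨U, Uᶜ, hU.isOpen, hU.isClosed.isOpen_compl, hx, hy, disjoint_compl_right⟩

theorem Psi.weaklyLocallyCompactSpace : WeaklyLocallyCompactSpace (Psi 𝒜) := by
  refine ⟨fun x => ?_⟩
  rcases Psi.cases_on x with ⟨n, rfl⟩ | ⟨A, rfl⟩
  · exact ⟨_, isCompact_singleton, (Psi.isOpen_singleton_ofNat n).mem_nhds rfl⟩
  · refine ⟨_, Psi.isCompact_basicNhd A (∅ : Finset ℕ),
      (Psi.isOpen_basicNhd A ∅).mem_nhds (Psi.ofMem_mem_basicNhd.2 rfl)⟩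

theorem Psi.denseRange_ofNat (h𝒜 : IsAlmostDisjointFamily 𝒜) :
    DenseRange (Psi.ofNat : ℕ → Psi 𝒜) := by
  intro x
  rcases Psi.cases_on x with ⟨n, rfl⟩ | ⟨A, rfl⟩
  · exact subset_closure ⟨n, rfl⟩
  · rw [mem_closure_iff_nhds]
    intro U hU
    obtain ⟨F, hF⟩ := Psi.exists_basicNhd_subset hU
    obtain ⟨n, hn⟩ := ((h𝒜.1 A A.2).sdiff F.finite_toSet).nonempty
    exact ⟨_, hF (Psi.ofNat_mem_basicNhd.2 hn), n, rfl⟩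

theorem Phi.separableSpace (h𝒜 : IsAlmostDisjointFamily 𝒜) :
    TopologicalSpace.SeparableSpace (Phi 𝒜) := by
  refine ⟨{OnePoint.infty} ∪ (fun n : ℕ => ((Psi.ofNat n : Psi 𝒜) : Phi 𝒜)) '' Set.univ,
    (Set.countable_singleton _).union (Set.countable_univ.image _), fun x => ?_⟩
  induction x using OnePoint.rec with
  | infty => exact subset_closure (Or.inl rfl)
  | coe y =>
    have h1 := image_closure_subset_closure_image
      (OnePoint.continuous_coe (X := Psi 𝒜)) ⟨y, Psi.denseRange_ofNat h𝒜 y, rfl⟩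
    refine closure_mono ?_ h1
    rintro _ ⟨_, ⟨n, rfl⟩, rfl⟩
    exact Or.inr ⟨n, trivial, rfl⟩

theorem IsAlmostDisjointFamily.isGoodFamily (h𝒜 : IsAlmostDisjointFamily 𝒜) (hc : #𝒜 = 𝔠) :
    IsGoodFamily 𝒜 where
  almostDisjoint := h𝒜
  hausdorff := by
    have := Psi.t2Space h𝒜
    have := Psi.weaklyLocallyCompactSpace (𝒜 := 𝒜)
    infer_instance
  compact := inferInstance
  separable := Phi.separableSpace h𝒜
  card := by
    have h1 : #(Phi 𝒜) = #(Option (ℕ ⊕ 𝒜)) := rfl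
    rw [h1, Cardinal.mk_option, Cardinal.mk_sum, hc]
    simp [Cardinal.add_one_eq aleph0_le_continuum]

/-- The compact open set `{n}`, respectively `{A} ∪ A`, around a point of `Ψ(𝒜)`. -/
def Psi.cell (t : Psi 𝒜) : Set (Psi 𝒜) :=
  {t} ∪ {x | ∃ A : 𝒜, t = Psi.ofMem A ∧ ∃ n ∈ (A : Set ℕ), x = Psi.ofNat n}

theorem Psi.cell_ofNat (n : ℕ) : Psi.cell (Psi.ofNat n : Psi 𝒜) = {Psi.ofNat n} := by
  ext x; simp [Psi.cell, Psi.ofNat_ne_ofMem]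

theorem Psi.cell_ofMem (A : 𝒜) : Psi.cell (Psi.ofMem A) = Psi.basicNhd A (∅ : Finset ℕ) := by
  ext x
  constructor
  · rintro (rfl | ⟨B, hB, n, hn, rfl⟩)
    · exact Psi.ofMem_mem_basicNhd.2 rfl
    · rw [Psi.ofMem_injective.eq_iff] at hB
      subst hB
      exact Psi.ofNat_mem_basicNhd.2 ⟨hn, by simp⟩
  · rintro (rfl | ⟨n, hn, rfl⟩)
    · exact Or.inl rfl
    · exact Or.inr ⟨A, rfl, n, hn.1, rfl⟩

theorem Psi.isCompact_cell (t : Psi 𝒜) : IsCompact (Psi.cell t) := by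
  rcases Psi.cases_on t with ⟨n, rfl⟩ | ⟨A, rfl⟩
  · rw [Psi.cell_ofNat]; exact isCompact_singleton
  · rw [Psi.cell_ofMem]; exact Psi.isCompact_basicNhd _ _

theorem Psi.isClosed_cell (h𝒜 : IsAlmostDisjointFamily 𝒜) (t : Psi 𝒜) :
    IsClosed (Psi.cell t) := by
  rcases Psi.cases_on t with ⟨n, rfl⟩ | ⟨A, rfl⟩
  · rw [Psi.cell_ofNat]; exact Psi.isClosed_singleton_ofNat n
  · rw [Psi.cell_ofMem]; exact Psi.isClosed_basicNhd h𝒜 _ _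

theorem Psi.isOpen_cell (t : Psi 𝒜) : IsOpen (Psi.cell t) := by
  rcases Psi.cases_on t with ⟨n, rfl⟩ | ⟨A, rfl⟩
  · rw [Psi.cell_ofNat]; exact Psi.isOpen_singleton_ofNat n
  · rw [Psi.cell_ofMem]; exact Psi.isOpen_basicNhd _ _

theorem Psi.mem_cell (t : Psi 𝒜) : t ∈ Psi.cell t := Or.inl rfl

/-- The complement of a cell is a neighbourhood of the point at infinity. -/
theorem Phi.compl_cell_mem_nhds_infty (h𝒜 : IsAlmostDisjointFamily 𝒜) (t : Psi 𝒜) :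
    (((↑) : Psi 𝒜 → Phi 𝒜) '' Psi.cell t)ᶜ ∈ 𝓝 (OnePoint.infty : Phi 𝒜) :=
  (OnePoint.isOpen_compl_image_coe.2 ⟨Psi.isClosed_cell h𝒜 t, Psi.isCompact_cell t⟩).mem_nhds
    OnePoint.infty_notMem_image_coe

/-- Every neighbourhood of the point at infinity contains the complement of a finite union of
cells. -/
theorem Phi.exists_finset_cell_of_mem_nhds_infty {U : Set (Phi 𝒜)}
    (hU : U ∈ 𝓝 (OnePoint.infty : Phi 𝒜)) :
    ∃ T : Finset (Psi 𝒜), ∀ x : Phi 𝒜,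
      (∀ t ∈ T, x ∉ ((↑) : Psi 𝒜 → Phi 𝒜) '' Psi.cell t) → x ∈ U := by
  obtain ⟨s, ⟨hs1, hs2⟩, hsU⟩ := OnePoint.hasBasis_nhds_infty.mem_iff.1 hU
  obtain ⟨T, hT⟩ := hs2.elim_finite_subcover (fun t : Psi 𝒜 => Psi.cell t)
    (fun t => Psi.isOpen_cell t) (fun t _ => Set.mem_iUnion.2 ⟨t, Psi.mem_cell t⟩)
  refine ⟨T, fun x hx => ?_⟩
  induction x using OnePoint.rec with
  | infty => exact mem_of_mem_nhds hU
  | coe y =>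
    refine hsU (Or.inl ⟨y, fun hy => ?_, rfl⟩)
    obtain ⟨t, ht, hyt⟩ := Set.mem_iUnion₂.1 (hT hy)
    exact hx t ht ⟨y, hyt, rfl⟩

end PsiTopology

/-! ## Families of sets that separate `FinBW(ρ₁)` from `FinBW(ρ₂)` -/

section Separation

/-- Every countable subfamily of `𝒱` has a `ρ`-pseudointersection `F`. -/
def IsRhoPoint {Λ : Type*} (ρ : Set ℕ → Set Λ) (𝒱 : Ultrafilter Λ) : Prop :=
  ∀ 𝒟 : Set (Set Λ), 𝒟.Countable → (∀ D ∈ 𝒟, D ∈ 𝒱) →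
    ∃ F : Set ℕ, F.Infinite ∧ ∀ D ∈ 𝒟, ∃ K : Finset ℕ, ρ (F \ (K : Set ℕ)) ⊆ D

/-- `ρ` is monotone with infinite values, and every `ρ(F)` belongs to a `ρ`-point. -/
structure IsRich {Λ : Type*} (ρ : Set ℕ → Set Λ) : Prop where
  mono : ∀ ⦃E F : Set ℕ⦄, E ⊆ F → ρ E ⊆ ρ F
  infinite : ∀ F : Set ℕ, F.Infinite → (ρ F).Infinite
  exists_point : ∀ F : Set ℕ, F.Infinite → ∃ 𝒱 : Ultrafilter Λ, ρ F ∈ 𝒱 ∧ IsRhoPoint ρ 𝒱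

/-- `C` contains no set of the form `ρ(E)` with `E` infinite. -/
def RhoSmall {Λ : Type*} (ρ : Set ℕ → Set Λ) (C : Set Λ) : Prop :=
  ∀ E : Set ℕ, E.Infinite → ¬ ρ E ⊆ C

theorem IsRich.rhoSmall_of_finite {Λ : Type*} {ρ : Set ℕ → Set Λ} (hρ : IsRich ρ) {C : Set Λ}
    (hC : C.Finite) : RhoSmall ρ C :=
  fun E hE h => hρ.infinite E hE (hC.subset h)

theorem IsRhoPoint.compl_mem {Λ : Type*} {ρ : Set ℕ → Set Λ} {𝒱 : Ultrafilter Λ}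
    (h𝒱 : IsRhoPoint ρ 𝒱) {C : Set Λ} (hC : RhoSmall ρ C) : Cᶜ ∈ 𝒱 := by
  rw [Ultrafilter.compl_mem_iff_notMem]
  intro h
  obtain ⟨F, hF, hFC⟩ := h𝒱 {C} (Set.countable_singleton C) (by simpa using h)
  obtain ⟨K, hK⟩ := hFC C rfl
  exact hC _ (hF.sdiff K.finite_toSet) hK

/-- Small sets are null for every `ρ`-point, so finitely many of them cannot cover `ρ F`. -/
theorem IsRich.exists_mem_diff {Λ : Type*} {ρ : Set ℕ → Set Λ} (hρ : IsRich ρ) {F : Set ℕ}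
    (hF : F.Infinite) (C : ℕ → Set Λ) (hC : ∀ n, RhoSmall ρ (C n)) (n : ℕ) :
    ∃ a ∈ ρ F, ∀ i ≤ n, a ∉ C i := by
  obtain ⟨𝒱, h1, h2⟩ := hρ.exists_point F hF
  have h3 : (⋂ i ∈ Finset.range (n + 1), (C i)ᶜ) ∈ 𝒱 :=
    (Filter.biInter_finset_mem _).2 fun i _ => h2.compl_mem (hC i)
  obtain ⟨a, ha, ha'⟩ := 𝒱.nonempty_of_mem (Filter.inter_mem h1 h3)
  refine ⟨a, ha, fun i hi => ?_⟩
  simp only [Set.mem_iInter, Finset.mem_range] at ha'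
  exact ha' i (by omega)

/-- A diagonal sequence picks its `n`-th term in `ρ (F \ n)` outside the first `n + 1` small sets.
Every infinite subset of its range still meets all tails of `ρ F` and is almost disjoint from `𝒞`,
so tallness can thin it to a small set. -/
theorem IsRich.exists_small_almostDisjoint {Λ : Type*} [Countable Λ] {ρ : Set ℕ → Set Λ}
    (hρ : IsRich ρ)
    (tall : ∀ S : Set Λ, S.Infinite → ∃ A ⊆ S, A.Infinite ∧ RhoSmall ρ A)
    {𝒞 : Set (Set Λ)} (h𝒞 : 𝒞.Countable) (hsmall : ∀ C ∈ 𝒞, RhoSmall ρ C)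
    {F : Set ℕ} (hF : F.Infinite) :
    ∃ A : Set Λ, A.Infinite ∧ RhoSmall ρ A ∧ (∀ C ∈ 𝒞, (A ∩ C).Finite) ∧
      ∀ K : Finset ℕ, (A ∩ ρ (F \ (K : Set ℕ))).Nonempty := by
  obtain ⟨p, -⟩ := (hρ.infinite F hF).nonempty
  -- Singletons join the list so that no value is taken infinitely often and the range is infinite.
  obtain ⟨C, hC⟩ := (h𝒞.union (Set.countable_range (fun a : Λ => ({a} : Set Λ)))).exists_eq_range
    ⟨{p}, Or.inr ⟨p, rfl⟩⟩
  have hCs : ∀ n, RhoSmall ρ (C n) := by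
    intro n
    have : C n ∈ 𝒞 ∪ Set.range (fun a : Λ => ({a} : Set Λ)) := hC ▸ Set.mem_range_self n
    rcases this with h | ⟨a, ha⟩
    · exact hsmall _ h
    · rw [← ha]
      exact hρ.rhoSmall_of_finite (Set.finite_singleton a)
  have hstep : ∀ n : ℕ, ∃ a ∈ ρ (F \ (Finset.range n : Set ℕ)), ∀ i ≤ n, a ∉ C i := fun n =>
    hρ.exists_mem_diff (hF.sdiff (Finset.range n).finite_toSet) C hCs n
  choose a ha haC using hstep
  have hidx : ∀ k, {n | a n ∈ C k}.Finite := fun k =>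
    (Set.finite_lt_nat k).subset fun n hn => not_le.1 fun h => haC n k h hn
  have hrange : (Set.range a).Infinite := by
    intro hfin
    obtain ⟨v, hv⟩ := @Finite.exists_infinite_fiber ℕ (Set.range a) _ hfin (Set.rangeFactorization a)
    obtain ⟨k, hk⟩ : ({v.1} : Set Λ) ∈ Set.range C := hC ▸ Or.inr ⟨v.1, rfl⟩
    refine (Set.infinite_coe_iff.1 hv) ((hidx k).subset fun n hn => ?_)
    have : a n = v.1 := congrArg Subtype.val hn
    rw [Set.mem_ofPred_eq, hk, this]
    rfl
  obtain ⟨A, hAS, hAinf, hAsmall⟩ := tall _ hrange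
  refine ⟨A, hAinf, hAsmall, fun D hD => ?_, fun K => ?_⟩
  · obtain ⟨k, hk⟩ : D ∈ Set.range C := hC ▸ Or.inl hD
    refine ((hidx k).image a).subset ?_
    rintro x ⟨hx, hxD⟩
    obtain ⟨n, rfl⟩ := hAS hx
    exact ⟨n, by rw [Set.mem_ofPred_eq, hk]; exact hxD, rfl⟩
  · have hAidx : {n | a n ∈ A}.Infinite := by
      intro hfin
      refine hAinf ((hfin.image a).subset fun x hx => ?_)
      obtain ⟨n, rfl⟩ := hAS hx
      exact ⟨n, hx, rfl⟩
    obtain ⟨n, hn, hnK⟩ := hAidx.exists_gt (K.sup id)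
    refine ⟨a n, hn, hρ.mono (Set.sdiff_subset_sdiff_right fun i hi => ?_) (ha n)⟩
    have : i ≤ K.sup id := Finset.le_sup (f := id) hi
    simpa using lt_of_le_of_lt this hnK

/-- A surjective coding of functions into `ℕ` with countable domain by sets of natural numbers. -/
theorem exists_surjective_set_nat (Λ : Type*) [Countable Λ] :
    ∃ c : Set ℕ → (Λ → ℕ), Function.Surjective c := by
  obtain ⟨i, hi⟩ := exists_injective_nat Λ
  have hinj : Function.Injective
      (fun g : Λ → ℕ => {n : ℕ | ∃ a, n = Nat.pair (i a) (g a)}) := by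
    intro g h hgh
    funext a
    have : Nat.pair (i a) (g a) ∈ {n : ℕ | ∃ a, n = Nat.pair (i a) (h a)} := by
      rw [← show _ = {n : ℕ | ∃ a, n = Nat.pair (i a) (h a)} from hgh]
      exact ⟨a, rfl⟩
    obtain ⟨b, hb⟩ := this
    obtain ⟨h1, h2⟩ := Nat.pair_eq_pair.1 hb
    rw [h2, hi h1]
  exact ⟨_, Function.invFun_surjective hinj⟩

theorem exists_separating_family (CH : Cardinal.continuum.{0} = Cardinal.aleph.{0} 1)
    {Λ : Type} [Countable Λ] {ρ₁ : Set ℕ → Set Λ} {ρ₂ : Set ℕ → Set ℕ}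
    (h₁ : IsRich ρ₁) (h₂ : IsRich ρ₂)
    (H : ∀ g : Λ → ℕ, ∃ F : Set ℕ, F.Infinite ∧ RhoSmall ρ₂ (g '' ρ₁ F)) :
    ∃ 𝒜 : Set (Set ℕ), IsAlmostDisjointFamily 𝒜 ∧ #𝒜 = 𝔠 ∧ (∀ A ∈ 𝒜, RhoSmall ρ₂ A) ∧
      (∀ F : Set ℕ, F.Infinite → ∃ A ∈ 𝒜, ∀ K : Finset ℕ, (A ∩ ρ₂ (F \ (K : Set ℕ))).Nonempty) ∧
      ∀ g : Λ → ℕ, ∃ F : Set ℕ, F.Infinite ∧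
        {A ∈ 𝒜 | (A ∩ g '' ρ₁ F).Infinite}.Countable := by
  classical
  -- Tallness is `H` applied to an injection of `Λ` into `S`.
  have tall : ∀ S : Set ℕ, S.Infinite → ∃ A ⊆ S, A.Infinite ∧ RhoSmall ρ₂ A := by
    intro S hS
    obtain ⟨i, hi⟩ := exists_injective_nat Λ
    have : Infinite S := hS.to_subtype
    let j := Infinite.natEmbedding S
    obtain ⟨F, hF, hs⟩ := H fun a => (j (i a) : ℕ)
    refine ⟨_, ?_, (h₁.infinite F hF).image ?_, hs⟩
    · rintro _ ⟨a, _, rfl⟩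
      exact (j (i a)).2
    · exact (Subtype.val_injective.comp (j.injective.comp hi)).injOn
  let I : Type := (Cardinal.continuum.{0}).ord.ToType
  have hI : #I = 𝔠 := by rw [Cardinal.mk_toType, Cardinal.card_ord]
  -- The only use of CH: proper initial segments of the index order are countable.
  have hIio : ∀ i : I, (Set.Iio i).Countable := by
    intro i
    rw [← Cardinal.le_aleph0_iff_set_countable, ← Order.lt_succ_iff, Cardinal.succ_aleph0, ← CH]
    exact (Cardinal.mk_Iio_lt i (by rw [hI]; simp [I])).trans_eq hI
  obtain ⟨code⟩ : Nonempty (I ≃ Set ℕ) := Cardinal.eq.1 (by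
    rw [hI, Cardinal.mk_set, Cardinal.mk_nat, Cardinal.two_power_aleph0])
  obtain ⟨c, hc⟩ := exists_surjective_set_nat Λ
  choose G hGinf hGsmall using H
  -- Each index codes both a function, whose small image is `B i`, and an infinite set `D i`;
  -- indices coding finite sets default to `univ`.
  let B : I → Set ℕ := fun i => c (code i) '' ρ₁ (G (c (code i)))
  let D : I → Set ℕ := fun i => if (code i).Infinite then code i else Set.univ
  have hD : ∀ i, (D i).Infinite := by
    intro i
    by_cases h : (code i).Infinite
    · simp [D, h]
    · simpa [D, h] using Set.infinite_univ
  have key : ∀ (i : I) (prev : ∀ j, j < i → {A : Set ℕ // RhoSmall ρ₂ A}),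
      ∃ A : {A : Set ℕ // RhoSmall ρ₂ A}, A.1.Infinite ∧
        (∀ j hj, (A.1 ∩ (prev j hj).1).Finite) ∧ (∀ j < i, (A.1 ∩ B j).Finite) ∧
        ∀ K : Finset ℕ, (A.1 ∩ ρ₂ (D i \ (K : Set ℕ))).Nonempty := by
    intro i prev
    have := (hIio i).to_subtype
    have hcount : (Set.range (fun j : Set.Iio i => (prev j.1 j.2).1) ∪ B '' Set.Iio i).Countable :=
      (Set.countable_range _).union ((hIio i).image B)
    obtain ⟨A, hA1, hA2, hA3, hA4⟩ := h₂.exists_small_almostDisjoint tall hcount (by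
      rintro C (⟨j, rfl⟩ | ⟨j, _, rfl⟩)
      · exact (prev j.1 j.2).2
      · exact hGsmall _) (hD i)
    exact ⟨⟨A, hA2⟩, hA1, fun j hj => hA3 _ (Or.inl ⟨⟨j, hj⟩, rfl⟩),
      fun j hj => hA3 _ (Or.inr ⟨j, hj, rfl⟩), hA4⟩
  choose step hstep1 hstep2 hstep3 hstep4 using key
  have wf : WellFounded ((· < ·) : I → I → Prop) := wellFounded_lt
  let A : I → {A : Set ℕ // RhoSmall ρ₂ A} := wf.fix step
  have hA : ∀ i, A i = step i fun j _ => A j := fun i => wf.fix_eq step i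
  have hAinf : ∀ i, (A i).1.Infinite := fun i => by rw [hA]; exact hstep1 _ _
  have hAlt : ∀ i j, j < i → ((A i).1 ∩ (A j).1).Finite := fun i j hj => by
    have := hstep2 i (fun j _ => A j) j hj
    rwa [← hA] at this
  have hAB : ∀ i j, j < i → ((A i).1 ∩ B j).Finite := fun i j hj => by
    have := hstep3 i (fun j _ => A j) j hj
    rwa [← hA] at this
  have hAD : ∀ i (K : Finset ℕ), ((A i).1 ∩ ρ₂ (D i \ (K : Set ℕ))).Nonempty := fun i K => by
    have := hstep4 i (fun j _ => A j) K
    rwa [← hA] at this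
  have hAne : ∀ i j, i ≠ j → ((A i).1 ∩ (A j).1).Finite := by
    intro i j hij
    rcases lt_or_gt_of_ne hij with h | h
    · rw [Set.inter_comm]; exact hAlt j i h
    · exact hAlt i j h
  have hinj : Function.Injective fun i => (A i).1 := by
    intro i j hij
    by_contra hne
    have h1 := hAne i j hne
    rw [show (A i).1 = (A j).1 from hij, Set.inter_self] at h1
    exact hAinf j h1
  refine ⟨Set.range fun i => (A i).1, ⟨?_, ?_⟩, ?_, ?_, ?_, ?_⟩
  · rintro _ ⟨i, rfl⟩
    exact hAinf i
  · rintro _ ⟨i, rfl⟩ _ ⟨j, rfl⟩ hij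
    exact hAne i j fun h => hij (by rw [h])
  · rw [Cardinal.mk_range_eq _ hinj, hI]
  · rintro _ ⟨i, rfl⟩
    exact (A i).2
  · intro F hF
    refine ⟨_, ⟨code.symm F, rfl⟩, fun K => ?_⟩
    have : D (code.symm F) = F := by simp [D, hF]
    simpa [this] using hAD (code.symm F) K
  · intro g
    obtain ⟨s, rfl⟩ := hc g
    refine ⟨G (c s), hGinf _, ?_⟩
    -- Members added after the stage of `g` are almost disjoint from its image; only the countably
    -- many up to that stage remain.
    refine (((hIio (code.symm s)).insert (code.symm s)).image fun i => (A i).1).mono ?_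
    rintro _ ⟨⟨i, rfl⟩, hi⟩
    refine ⟨i, ?_, rfl⟩
    by_contra hlt
    have hlt_i : code.symm s < i := by
      simp only [Set.mem_insert_iff, Set.mem_Iio, not_or, not_lt] at hlt
      exact lt_of_le_of_ne hlt.2 (Ne.symm hlt.1)
    refine hi ?_
    simpa [B] using hAB i _ hlt_i

/-- The partial map from `Φ(𝒜)` to `ℕ`, extended by `0`. -/
theorem Phi.exists_natPart (𝒜 : Set (Set ℕ)) : ∃ π : Phi 𝒜 → ℕ, ∀ n, π (Psi.ofNat n : Psi 𝒜) = n :=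
  ⟨fun x => x.elim 0 fun y => Sum.elim id (fun _ => 0) y, fun _ => rfl⟩

theorem Phi.cases_on {𝒜 : Set (Set ℕ)} (x : Phi 𝒜) : x = OnePoint.infty ∨
    (∃ n, x = (Psi.ofNat n : Psi 𝒜)) ∨ ∃ A : 𝒜, x = (Psi.ofMem A : Psi 𝒜) := by
  induction x using OnePoint.rec with
  | infty => exact Or.inl rfl
  | coe y =>
    rcases Psi.cases_on y with ⟨n, rfl⟩ | ⟨A, rfl⟩
    · exact Or.inr (Or.inl ⟨n, rfl⟩)
    · exact Or.inr (Or.inr ⟨A, rfl⟩)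

/-- Compact subsets of `Ψ(𝒜)` are covered by finitely many cells, so it suffices to leave one cell
at a time. -/
theorem rhoConverges_infty_iff {Λ : Type*} {ρ : Set ℕ → Set Λ}
    (mono : ∀ ⦃E F : Set ℕ⦄, E ⊆ F → ρ E ⊆ ρ F) {𝒜 : Set (Set ℕ)}
    (h𝒜 : IsAlmostDisjointFamily 𝒜) (F : Set ℕ) (f : Λ → Phi 𝒜) :
    RhoConverges ρ F f OnePoint.infty ↔ ∀ t : Psi 𝒜, ∃ K : Finset ℕ,
      ∀ a ∈ ρ (F \ (K : Set ℕ)), f a ∉ ((↑) : Psi 𝒜 → Phi 𝒜) '' Psi.cell t := by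
  classical
  constructor
  · intro h t
    obtain ⟨K, hK⟩ := h _ (Phi.compl_cell_mem_nhds_infty h𝒜 t)
    exact ⟨K, fun a ha => hK ⟨a, ha, rfl⟩⟩
  · intro h U hU
    choose K hK using h
    obtain ⟨T, hT⟩ := Phi.exists_finset_cell_of_mem_nhds_infty hU
    refine ⟨T.biUnion K, ?_⟩
    rintro _ ⟨a, ha, rfl⟩
    refine hT _ fun t ht => hK t a (mono ?_ ha)
    refine Set.sdiff_subset_sdiff_right ?_
    exact_mod_cast Finset.subset_biUnion_of_mem K ht

theorem Phi.finBW_of_countable_traces {Λ : Type*} [Countable Λ] {ρ : Set ℕ → Set Λ}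
    (hρ : IsRich ρ) {𝒜 : Set (Set ℕ)} (h𝒜 : IsAlmostDisjointFamily 𝒜)
    (H : ∀ g : Λ → ℕ, ∃ F : Set ℕ, F.Infinite ∧ {A ∈ 𝒜 | (A ∩ g '' ρ F).Infinite}.Countable) :
    FinBW ρ (Phi 𝒜) := by
  classical
  intro f
  obtain ⟨π, hπ⟩ := Phi.exists_natPart 𝒜
  obtain ⟨F₀, hF₀, hcount⟩ := H (π ∘ f)
  obtain ⟨𝒱, hF𝒱, h𝒱⟩ := hρ.exists_point F₀ hF₀
  -- The push-forward of the `ρ`-point converges by compactness; its limit is the required point.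
  obtain ⟨x, -, hx⟩ := isCompact_iff_ultrafilter_le_nhds.1 (isCompact_univ (X := Phi 𝒜))
    (𝒱.map f) (by simp)
  have hx' : ∀ U ∈ 𝓝 x, f ⁻¹' U ∈ 𝒱 := fun U hU => hx hU
  rcases Phi.cases_on x with rfl | ⟨n, rfl⟩ | ⟨A, rfl⟩
  -- Countably many cells are avoided through the `ρ`-point. Any other cell is that of some `A`
  -- which is not a value of `f` and has finite trace, so leaving it reduces to leaving finitely
  -- many cells `{n}`.
  · let bad : Set (Psi 𝒜) := Set.range Psi.ofNat ∪
      (Psi.ofMem '' {A : 𝒜 | ((A : Set ℕ) ∩ (π ∘ f) '' ρ F₀).Infinite} ∪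
      {t | ∃ a, f a = t})
    have hbad : bad.Countable := by
      refine (Set.countable_range _).union (Set.Countable.union (Set.Countable.image ?_ _) ?_)
      · refine (hcount.preimage_of_injOn (Subtype.val_injective (p := (· ∈ 𝒜))).injOn).mono ?_
        exact fun A hA => ⟨A.2, hA⟩
      · refine Set.Countable.preimage_of_injOn (Set.countable_range f)
          (OnePoint.coe_injective.injOn) |>.mono ?_
        rintro t ⟨a, ha⟩
        exact ⟨a, ha⟩
    obtain ⟨F, hF, hFD⟩ := h𝒱
      (insert (ρ F₀) ((fun t => f ⁻¹' (((↑) : Psi 𝒜 → Phi 𝒜) '' Psi.cell t)ᶜ) '' bad))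
      ((hbad.image _).insert _) (by
        rintro D (rfl | ⟨t, _, rfl⟩)
        · exact hF𝒱
        · exact hx' _ (Phi.compl_cell_mem_nhds_infty h𝒜 t))
    refine ⟨F, hF, _, (rhoConverges_infty_iff hρ.mono h𝒜 F f).2 fun t => ?_⟩
    have hgood : ∀ t ∈ bad, ∃ K : Finset ℕ,
        ∀ a ∈ ρ (F \ (K : Set ℕ)), f a ∉ ((↑) : Psi 𝒜 → Phi 𝒜) '' Psi.cell t := by
      intro t ht
      obtain ⟨K, hK⟩ := hFD _ (Or.inr ⟨t, ht, rfl⟩)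
      exact ⟨K, fun a ha => hK ha⟩
    by_cases ht : t ∈ bad
    · exact hgood t ht
    rcases Psi.cases_on t with ⟨n, rfl⟩ | ⟨A, rfl⟩
    · exact absurd (Or.inl ⟨n, rfl⟩) ht
    have hfin : ((A : Set ℕ) ∩ (π ∘ f) '' ρ F₀).Finite := by
      by_contra h
      exact ht (Or.inr (Or.inl ⟨A, h, rfl⟩))
    obtain ⟨K₀, hK₀⟩ := hFD _ (Or.inl rfl)
    choose K hK using fun n : ℕ => hgood (Psi.ofNat n) (Or.inl ⟨n, rfl⟩)
    refine ⟨K₀ ∪ hfin.toFinset.biUnion K, ?_⟩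
    rintro a ha ⟨y, hy, hya⟩
    rcases hy with rfl | ⟨B, hB, n, hn, rfl⟩
    · exact ht (Or.inr (Or.inr ⟨a, hya.symm⟩))
    · rw [Psi.ofMem_injective.eq_iff] at hB
      subst hB
      have h0 : a ∈ ρ F₀ := by
        refine hK₀ (hρ.mono (Set.sdiff_subset_sdiff_right ?_) ha)
        exact_mod_cast Finset.subset_union_left
      have hn' : n ∈ hfin.toFinset := by
        rw [Set.Finite.mem_toFinset]
        exact ⟨hn, a, h0, by rw [Function.comp_apply, ← hya, hπ]⟩
      refine hK n a (hρ.mono (Set.sdiff_subset_sdiff_right ?_) ha) ⟨_, Psi.mem_cell _, hya⟩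
      exact_mod_cast (Finset.subset_biUnion_of_mem K hn').trans Finset.subset_union_right
  · have hopen : {((Psi.ofNat n : Psi 𝒜) : Phi 𝒜)} ∈ 𝓝 ((Psi.ofNat n : Psi 𝒜) : Phi 𝒜) := by
      rw [← Set.image_singleton]
      exact (OnePoint.isOpen_image_coe.2 (Psi.isOpen_singleton_ofNat n)).mem_nhds ⟨_, rfl, rfl⟩
    obtain ⟨F, hF, hFD⟩ := h𝒱 {f ⁻¹' {((Psi.ofNat n : Psi 𝒜) : Phi 𝒜)}}
      (Set.countable_singleton _) (by rintro D rfl; exact hx' _ hopen)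
    refine ⟨F, hF, ((Psi.ofNat n : Psi 𝒜) : Phi 𝒜), fun U hU => ?_⟩
    obtain ⟨K, hK⟩ := hFD _ rfl
    refine ⟨K, ?_⟩
    rintro _ ⟨a, ha, rfl⟩
    rw [show f a = _ from hK ha]
    exact mem_of_mem_nhds hU
  · obtain ⟨F, hF, hFD⟩ := h𝒱 (Set.range fun G : Finset ℕ =>
        f ⁻¹' (((↑) : Psi 𝒜 → Phi 𝒜) '' Psi.basicNhd A (G : Set ℕ)))
      (Set.countable_range _) (by
        rintro D ⟨G, rfl⟩
        exact hx' _ ((OnePoint.isOpen_image_coe.2 (Psi.isOpen_basicNhd A G)).mem_nhds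
          ⟨_, Psi.ofMem_mem_basicNhd.2 rfl, rfl⟩))
    refine ⟨F, hF, ((Psi.ofMem A : Psi 𝒜) : Phi 𝒜), fun U hU => ?_⟩
    rw [OnePoint.nhds_coe_eq, Filter.mem_map] at hU
    obtain ⟨G, hG⟩ := Psi.exists_basicNhd_subset hU
    obtain ⟨K, hK⟩ := hFD _ ⟨G, rfl⟩
    refine ⟨K, ?_⟩
    rintro _ ⟨a, ha, rfl⟩
    obtain ⟨y, hy, hya⟩ := hK ha
    rw [← hya]
    exact hG hy

/-- The inclusion of `ℕ` is the witness: the limit `∞` contradicts `hmeet`, a limit in `ℕ`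
contradicts infinitude of `ρ F`, and a limit `A` would put some `ρ (F \ K)` inside `A`. -/
theorem Phi.not_finBW_of_small {ρ : Set ℕ → Set ℕ} (hρ : IsRich ρ) {𝒜 : Set (Set ℕ)}
    (h𝒜 : IsAlmostDisjointFamily 𝒜) (hsmall : ∀ A ∈ 𝒜, RhoSmall ρ A)
    (hmeet : ∀ F : Set ℕ, F.Infinite →
      ∃ A ∈ 𝒜, ∀ K : Finset ℕ, (A ∩ ρ (F \ (K : Set ℕ))).Nonempty) :
    ¬ FinBW ρ (Phi 𝒜) := by
  intro h
  obtain ⟨F, hF, x, hx⟩ := h fun n => ((Psi.ofNat n : Psi 𝒜) : Phi 𝒜)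
  rcases Phi.cases_on x with rfl | ⟨n, rfl⟩ | ⟨A, rfl⟩
  · obtain ⟨A, hA, hAF⟩ := hmeet F hF
    obtain ⟨K, hK⟩ := (rhoConverges_infty_iff hρ.mono h𝒜 F _).1 hx (Psi.ofMem ⟨A, hA⟩)
    obtain ⟨n, hn, hnF⟩ := hAF K
    exact hK n hnF ⟨_, Or.inr ⟨⟨A, hA⟩, rfl, n, hn, rfl⟩, rfl⟩
  · obtain ⟨K, hK⟩ := hx _ ((OnePoint.isOpen_image_coe.2
      (Psi.isOpen_singleton_ofNat n)).mem_nhds ⟨_, rfl, rfl⟩)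
    refine hρ.infinite _ (hF.sdiff K.finite_toSet) ((Set.finite_singleton n).subset fun m hm => ?_)
    obtain ⟨y, hy, hym⟩ := hK ⟨m, hm, rfl⟩
    rw [Set.mem_singleton_iff.1 hy, OnePoint.coe_eq_coe, Psi.ofNat_injective.eq_iff] at hym
    exact hym.symm
  · obtain ⟨K, hK⟩ := hx _ ((OnePoint.isOpen_image_coe.2
      (Psi.isOpen_basicNhd A ∅)).mem_nhds ⟨_, Psi.ofMem_mem_basicNhd.2 rfl, rfl⟩)
    refine hsmall A A.2 _ (hF.sdiff K.finite_toSet) fun m hm => ?_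
    obtain ⟨y, hy, hym⟩ := hK ⟨m, hm, rfl⟩
    rw [OnePoint.coe_eq_coe] at hym
    rw [hym, Psi.ofNat_mem_basicNhd] at hy
    exact hy.1

theorem exists_isGoodFamily (CH : Cardinal.continuum.{0} = Cardinal.aleph.{0} 1)
    {Λ : Type} [Countable Λ] {ρ₁ : Set ℕ → Set Λ} {ρ₂ : Set ℕ → Set ℕ}
    (h₁ : IsRich ρ₁) (h₂ : IsRich ρ₂)
    (H : ∀ g : Λ → ℕ, ∃ F : Set ℕ, F.Infinite ∧ RhoSmall ρ₂ (g '' ρ₁ F)) :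
    ∃ 𝒜 : Set (Set ℕ), IsGoodFamily 𝒜 ∧ FinBW ρ₁ (Phi 𝒜) ∧ ¬ FinBW ρ₂ (Phi 𝒜) := by
  obtain ⟨𝒜, h𝒜, hcard, hsmall, hmeet, htr⟩ := exists_separating_family CH h₁ h₂ H
  exact ⟨𝒜, h𝒜.isGoodFamily hcard, Phi.finBW_of_countable_traces h₁ h𝒜 htr,
    Phi.not_finBW_of_small h₂ h𝒜 hsmall hmeet⟩

end Separation

/-! ## Sequences guided by an ultrafilter -/

section Guided

/-- The requirement on each term may depend on the finite set of earlier terms, which is carried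
along the recursion. -/
theorem exists_strictMono_mem {U : Ultrafilter ℕ} (hU : (U : Filter ℕ) ≤ Filter.cofinite)
    (S : ℕ → Finset ℕ → Set ℕ) (hS : ∀ n h, S n h ∈ U) :
    ∃ x : ℕ → ℕ, StrictMono x ∧ ∀ n, x n ∈ S n ((Finset.range n).image x) := by
  have hex : ∀ n (h : Finset ℕ), ∃ m, m ∈ S n h ∧ ∀ k ∈ h, k < m := by
    intro n h
    have h1 : {m | ∀ k ∈ h, k < m} ∈ U := by
      refine (Filter.eventually_all_finset h).2 fun k _ => hU ?_
      refine (Set.finite_le_nat k).subset fun m hm => ?_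
      simpa using hm
    exact U.nonempty_of_mem (Filter.inter_mem (hS n h) h1)
  choose m hmS hm using hex
  let H : ℕ → Finset ℕ := fun n => Nat.rec ∅ (fun n h => insert (m n h) h) n
  have hsucc : ∀ n, H (n + 1) = insert (m n (H n)) (H n) := fun n => rfl
  have hH : ∀ n, H n = (Finset.range n).image fun n => m n (H n) := by
    intro n
    induction n with
    | zero => rfl
    | succ n ih => rw [hsucc, Finset.range_add_one, Finset.image_insert, ← ih]
  refine ⟨fun n => m n (H n), strictMono_nat_of_lt_succ fun n => ?_, fun n => ?_⟩
  · refine hm (n + 1) _ _ ?_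
    rw [hsucc]
    exact Finset.mem_insert_self _ _
  · rw [← hH]
    exact hmS n (H n)

/-- Allows a condition "`m ∈ D` if `D` is large" to be imposed before `D` is known to be large;
largeness is supplied later by the terms themselves. -/
theorem eventually_mem_of_mem (U : Ultrafilter ℕ) (D : Set ℕ) : ∀ᶠ m in U, D ∈ U → m ∈ D := by
  by_cases h : D ∈ U
  · filter_upwards [h] with m hm _ using hm
  · exact Filter.Eventually.of_forall fun m h' => absurd h' h

theorem exists_ultrafilter_mem_of_infinite {F : Set ℕ} (hF : F.Infinite) :
    ∃ U : Ultrafilter ℕ, (U : Filter ℕ) ≤ Filter.cofinite ∧ F ∈ U := by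
  have : (Filter.cofinite ⊓ Filter.principal F).NeBot :=
    Filter.cofinite_inf_principal_neBot_iff.2 hF
  have h := Ultrafilter.of_le (Filter.cofinite ⊓ Filter.principal F)
  exact ⟨_, h.trans inf_le_left, Filter.le_principal_iff.1 (h.trans inf_le_right)⟩

end Guided

/-! ## Pairs -/

section Pairs

/-- The unordered pair `{k, m}` for `k ≠ m`. -/
def natPair (k m : ℕ) : NatPair :=
  if h : k ≠ m then ⟨{k, m}, Finset.card_pair h⟩ else ⟨{0, 1}, Finset.card_pair zero_ne_one⟩

theorem natPair_val {k m : ℕ} (h : k < m) : (natPair k m).1 = {k, m} := by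
  simp [natPair, h.ne]

theorem natPair_mem_pairsOf {k m : ℕ} (h : k < m) {F : Set ℕ} :
    natPair k m ∈ pairsOf F ↔ k ∈ F ∧ m ∈ F := by
  simp [pairsOf, natPair_val h, Set.insert_subset_iff]

theorem exists_eq_natPair (p : NatPair) : ∃ k m, k < m ∧ p = natPair k m := by
  obtain ⟨a, b, hab, hp⟩ := Finset.card_eq_two.1 p.2
  rcases lt_or_gt_of_ne hab with h | h
  · exact ⟨a, b, h, Subtype.ext (by rw [hp, natPair_val h])⟩
  · exact ⟨b, a, h, Subtype.ext (by rw [hp, natPair_val h, Finset.pair_comm])⟩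

theorem natPair_inj {k m k' m' : ℕ} (h : k < m) (h' : k' < m') (he : natPair k m = natPair k' m') :
    k = k' ∧ m = m' := by
  have h1 : ({k, m} : Finset ℕ) = {k', m'} := by rw [← natPair_val h, ← natPair_val h', he]
  have h2 : k ∈ ({k', m'} : Finset ℕ) := h1 ▸ by simp
  have h3 : m ∈ ({k', m'} : Finset ℕ) := h1 ▸ by simp
  have h4 : k' ∈ ({k, m} : Finset ℕ) := h1 ▸ by simp
  simp only [Finset.mem_insert, Finset.mem_singleton] at h2 h3 h4
  omega

theorem exists_of_mem_pairsOf_range {x : ℕ → ℕ} (hx : StrictMono x) {p : NatPair} {F : Set ℕ}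
    (hF : F ⊆ Set.range x) (hp : p ∈ pairsOf F) :
    ∃ i j, i < j ∧ x i ∈ F ∧ x j ∈ F ∧ p = natPair (x i) (x j) := by
  obtain ⟨k, m, hkm, rfl⟩ := exists_eq_natPair p
  obtain ⟨hk, hm⟩ := (natPair_mem_pairsOf hkm).1 hp
  obtain ⟨i, rfl⟩ := hF hk
  obtain ⟨j, rfl⟩ := hF hm
  exact ⟨i, j, hx.lt_iff_lt.1 hkm, hk, hm, rfl⟩

theorem pairsOf_infinite {F : Set ℕ} (hF : F.Infinite) : (pairsOf F).Infinite := by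
  intro hfin
  refine hF ((hfin.biUnion fun p _ => p.1.finite_toSet).subset fun a ha => ?_)
  obtain ⟨b, hb, hab⟩ := hF.exists_gt a
  refine Set.mem_biUnion ((natPair_mem_pairsOf hab).2 ⟨ha, hb⟩) ?_
  rw [natPair_val hab]
  simp

theorem not_lt_of_notMem_image {x : ℕ → ℕ} {n i : ℕ}
    (h : x i ∉ ((Finset.range n).image x : Finset ℕ)) : n ≤ i := by
  by_contra hlt
  exact h (Finset.mem_image_of_mem x (Finset.mem_range.2 (not_le.1 hlt)))

/-- The `ρ`-point is `U ⊗ U`. Given large sets `A n`, the sequence is chosen so that `{x i, x j}`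
lies in `A n` whenever `n ≤ i < j`. -/
theorem isRich_pairsOf : IsRich pairsOf where
  mono _ _ h _ hp := Set.Subset.trans hp h
  infinite _ := pairsOf_infinite
  exists_point F hF := by
    obtain ⟨U, hU, hFU⟩ := exists_ultrafilter_mem_of_infinite hF
    have hgt : ∀ k, ∀ᶠ m in U, k < m := fun k =>
      hU ((Set.finite_le_nat k).subset fun m hm => by simpa using hm)
    refine ⟨U.bind fun k => U.map (natPair k), ?_, ?_⟩
    · change ∀ᶠ k in U, ∀ᶠ m in U, natPair k m ∈ pairsOf F
      filter_upwards [hFU] with k hk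
      filter_upwards [hFU, hgt k] with m hm hkm
      exact (natPair_mem_pairsOf hkm).2 ⟨hk, hm⟩
    · intro 𝒟 h𝒟 hmem
      obtain ⟨A, hA⟩ := (h𝒟.insert Set.univ).exists_eq_range (Set.insert_nonempty _ _)
      -- Adding `univ` to `𝒟` only guarantees that there is something to enumerate.
      have hAm : ∀ n, ∀ᶠ k in U, ∀ᶠ m in U, natPair k m ∈ A n := by
        intro n
        have h1 : A n ∈ insert Set.univ 𝒟 := hA ▸ Set.mem_range_self n
        rcases h1 with h | h
        · rw [h]; simp
        · exact hmem _ h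
      obtain ⟨x, hx, hxS⟩ := exists_strictMono_mem hU
        (fun n h => {k | (∀ i ∈ Finset.range (n + 1), ∀ᶠ m in U, natPair k m ∈ A i) ∧
          ∀ l ∈ h, ∀ i ∈ Finset.range (n + 1),
            {m | natPair l m ∈ A i} ∈ U → k ∈ {m | natPair l m ∈ A i}}) (fun n h =>
          Filter.Eventually.and ((Filter.eventually_all_finset _).2 fun i _ => hAm i)
            ((Filter.eventually_all_finset _).2 fun l _ => (Filter.eventually_all_finset _).2
              fun i _ => eventually_mem_of_mem U _))
      refine ⟨Set.range x, Set.infinite_range_of_injective hx.injective, fun D hD => ?_⟩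
      obtain ⟨n, rfl⟩ : D ∈ Set.range A := hA ▸ Or.inr hD
      refine ⟨(Finset.range n).image x, fun p hp => ?_⟩
      obtain ⟨i, j, hij, hi, hj, rfl⟩ := exists_of_mem_pairsOf_range hx Set.sdiff_subset hp
      have hi' := not_lt_of_notMem_image hi.2
      exact (hxS j).2 (x i) (Finset.mem_image_of_mem x (Finset.mem_range.2 hij)) n
        (Finset.mem_range.2 (by omega)) ((hxS i).1 n (Finset.mem_range.2 (by omega)))

/-- A weak canonical Ramsey theorem for pairs: along a suitable sequence, `b` depends only on the
smaller index, either constantly or injectively, or `b` determines the larger index. -/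
theorem exists_pair_canonical (U : Ultrafilter ℕ) (b : ℕ → ℕ → ℕ) :
    ∃ S : ℕ → Finset ℕ → Set ℕ, (∀ n h, S n h ∈ U) ∧
      ∀ x : ℕ → ℕ, (∀ n, x n ∈ S n ((Finset.range n).image x)) →
        (∃ L : ℕ → ℕ, (∀ i j, i < j → b (x i) (x j) = L i) ∧
          ((∀ i j, L i = L j) ∨ Function.Injective L)) ∨
        ∀ i j i' j', i < j → i' < j' → b (x i) (x j) = b (x i') (x j') → j = j' := by
  have himg : ∀ (x : ℕ → ℕ) {i n : ℕ}, i < n → x i ∈ (Finset.range n).image x := fun x i n h =>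
    Finset.mem_image_of_mem x (Finset.mem_range.2 h)
  -- Either `b k ·` takes each value on a null set for almost all `k`, and new larger indices can
  -- avoid all old values, or `b k ·` has a limit `L k`, which is itself constant or avoids each
  -- value almost everywhere.
  by_cases hB : ∀ᶠ k in U, ∀ v, ∀ᶠ m in U, b k m ≠ v
  · refine ⟨fun n h => {m | (∀ v, ∀ᶠ m' in U, b m m' ≠ v) ∧ ∀ k ∈ h, ∀ k₁ ∈ h, ∀ k₂ ∈ h,
      {m | b k m ≠ b k₁ k₂} ∈ U → m ∈ {m | b k m ≠ b k₁ k₂}}, fun n h => ?_, fun x hx => ?_⟩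
    · exact Filter.Eventually.and hB ((Filter.eventually_all_finset _).2 fun k _ =>
        (Filter.eventually_all_finset _).2 fun k₁ _ => (Filter.eventually_all_finset _).2
          fun k₂ _ => eventually_mem_of_mem U _)
    · right
      have key : ∀ i j i' j', i < j → i' < j' → j' < j → b (x i) (x j) ≠ b (x i') (x j') :=
        fun i j i' j' h1 h2 h3 => (hx j).2 _ (himg x h1) _ (himg x (h2.trans h3)) _ (himg x h3)
          ((hx i).1 _)
      intro i j i' j' h1 h2 he
      rcases lt_trichotomy j j' with h | h | h
      · exact absurd he.symm (key i' j' i j h2 h1 h)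
      · exact h
      · exact absurd he (key i j i' j' h1 h2 h)
  · have hA : ∀ᶠ k in U, ∃ v, ∀ᶠ m in U, b k m = v := by
      filter_upwards [Ultrafilter.eventually_not.2 hB] with k hk
      push Not at hk
      exact hk
    obtain ⟨L, hL⟩ : ∃ L : ℕ → ℕ, ∀ᶠ k in U, ∀ᶠ m in U, b k m = L k := by
      classical
      refine ⟨fun k => if h : ∃ v, ∀ᶠ m in U, b k m = v then h.choose else 0, ?_⟩
      filter_upwards [hA] with k hk
      simp only [hk, dif_pos]
      exact hk.choose_spec
    by_cases hc : ∃ v, ∀ᶠ k in U, L k = v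
    · obtain ⟨v, hv⟩ := hc
      refine ⟨fun n h => {m | ((∀ᶠ m' in U, b m m' = L m) ∧ L m = v) ∧ ∀ k ∈ h,
        {m | b k m = L k} ∈ U → m ∈ {m | b k m = L k}}, fun n h => ?_, fun x hx => ?_⟩
      · exact (hL.and hv).and ((Filter.eventually_all_finset _).2 fun k _ =>
          eventually_mem_of_mem U _)
      · exact Or.inl ⟨fun i => L (x i), fun i j hij => (hx j).2 _ (himg x hij) (hx i).1.1,
          Or.inl fun i j => (hx i).1.2.trans (hx j).1.2.symm⟩
    · refine ⟨fun n h => {m | ((∀ᶠ m' in U, b m m' = L m) ∧ ∀ k ∈ h, L m ≠ L k) ∧ ∀ k ∈ h,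
        {m | b k m = L k} ∈ U → m ∈ {m | b k m = L k}}, fun n h => ?_, fun x hx => ?_⟩
      · refine (hL.and ((Filter.eventually_all_finset _).2 fun k _ => ?_)).and
          ((Filter.eventually_all_finset _).2 fun k _ => eventually_mem_of_mem U _)
        exact Ultrafilter.eventually_not.2 fun h => hc ⟨_, h⟩
      · refine Or.inl ⟨fun i => L (x i), fun i j hij => (hx j).2 _ (himg x hij) (hx i).1.1,
          Or.inr fun i j hij => ?_⟩
        rcases lt_trichotomy i j with h | h | h
        · exact absurd hij.symm ((hx j).1.2 _ (himg x h))
        · exact h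
        · exact absurd hij ((hx i).1.2 _ (himg x h))

end Pairs

/-! ## Finite sums and idempotent ultrafilters -/

section Sums

/-- A non-principal ultrafilter on `ℕ` that is idempotent for addition. -/
structure IsSumIdempotent (U : Ultrafilter ℕ) : Prop where
  le_cofinite : (U : Filter ℕ) ≤ Filter.cofinite
  idem : ∀ X ∈ U, {s | {t | s + t ∈ X} ∈ U} ∈ U

theorem subset_finiteSums (F : Set ℕ) : F ⊆ finiteSums F := fun n hn =>
  ⟨{n}, Finset.singleton_nonempty n, by simpa using hn, by simp⟩

theorem finiteSums_mono {E F : Set ℕ} (h : E ⊆ F) : finiteSums E ⊆ finiteSums F := by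
  rintro n ⟨α, h1, h2, h3⟩
  exact ⟨α, h1, h2.trans h, h3⟩

theorem exists_finset_of_mem_hindmanFS (a : Stream' ℕ) (m : ℕ) (hm : m ∈ Hindman.FS a) :
    ∃ α : Finset ℕ, α.Nonempty ∧ m = ∑ i ∈ α, a.get i := by
  have hshift : ∀ (b : Stream' ℕ) (α : Finset ℕ), ∑ i ∈ α, b.tail.get i =
      ∑ i ∈ α.map (addRightEmbedding 1), b.get i := fun b α => by
    rw [Finset.sum_map]; rfl
  induction hm with
  | head' b => exact ⟨{0}, Finset.singleton_nonempty 0, by simp [Stream'.head]⟩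
  | tail' b m _ ih =>
    obtain ⟨α, h1, rfl⟩ := ih
    exact ⟨_, h1.map, hshift b α⟩
  | cons' b m _ ih =>
    obtain ⟨α, h1, rfl⟩ := ih
    refine ⟨insert 0 (α.map (addRightEmbedding 1)), Finset.insert_nonempty _ _, ?_⟩
    rw [Finset.sum_insert (by simp), hshift]

theorem exists_isSumIdempotent_mem {F : Set ℕ} (hF : F.Infinite) :
    ∃ U : Ultrafilter ℕ, IsSumIdempotent U ∧ finiteSums F ∈ U := by
  -- Removing `0` makes all sums positive, so the idempotent is non-principal: `{a}` large would
  -- give `a + a = a`.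
  have hF' : (F \ {0}).Infinite := hF.sdiff (Set.finite_singleton 0)
  have : Infinite (F \ {0} : Set ℕ) := hF'.to_subtype
  let j := Infinite.natEmbedding (F \ {0} : Set ℕ)
  obtain ⟨U, hidem, hU⟩ := Hindman.exists_idempotent_ultrafilter_le_FS
    (fun n => (j n : ℕ) : Stream' ℕ)
  have hpos : ∀ᶠ m in U, 0 < m ∧ m ∈ finiteSums F := by
    filter_upwards [hU] with m hm
    obtain ⟨α, hα, rfl⟩ := exists_finset_of_mem_hindmanFS _ m hm
    constructor
    · refine Finset.sum_pos (fun i _ => ?_) hα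
      exact Nat.pos_of_ne_zero (j i).2.2
    · refine ⟨α.image fun n => (j n : ℕ), hα.image _, ?_, ?_⟩
      · intro x hx
        obtain ⟨i, -, rfl⟩ := Finset.mem_image.1 (Finset.mem_coe.1 hx)
        exact (j i).2.1
      · exact (Finset.sum_image (f := fun i => i) (g := fun n => (j n : ℕ))
          (Subtype.val_injective.comp j.injective).injOn).symm
  have hidem' : ∀ X ∈ U, {s | {t | s + t ∈ X} ∈ U} ∈ U := by
    intro X hX
    have h1 : ∀ᶠ m in (↑(Ultrafilter.add.add U U) : Filter ℕ), m ∈ X := by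
      have : Ultrafilter.add.add U U = U := hidem
      rw [this]
      exact hX
    exact (Ultrafilter.eventually_add U U _).1 h1
  refine ⟨U, ⟨?_, hidem'⟩, hpos.mono fun m hm => hm.2⟩
  rw [Filter.le_cofinite_iff_compl_singleton_mem]
  intro a
  change {a}ᶜ ∈ U
  rw [Ultrafilter.compl_mem_iff_notMem]
  intro ha
  have h1 := Filter.inter_mem (hidem' _ ha) (Filter.inter_mem ha hpos)
  obtain ⟨s, hs, hs', hs''⟩ := U.nonempty_of_mem h1
  obtain ⟨t, ht, ht'⟩ := U.nonempty_of_mem (Filter.inter_mem hs ha)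
  have h2 : s + t = a := ht
  have h3 : s = a := hs'
  have h4 : t = a := ht'
  have h5 : 0 < s := hs''.1
  omega

/-- The residue class that is large must satisfy `r + r ≡ r`, hence is zero. -/
theorem IsSumIdempotent.dvd_mem {U : Ultrafilter ℕ} (hU : IsSumIdempotent U) {N : ℕ}
    (hN : 0 < N) : {n | N ∣ n} ∈ U := by
  have h1 : (⋃ r ∈ Finset.range N, {n | n % N = r}) ∈ U :=
    Filter.mem_of_superset Filter.univ_mem fun n _ => by
      simp [Nat.mod_lt n hN]
  obtain ⟨r, -, hr⟩ := (Ultrafilter.finite_biUnion_mem_iff (Finset.finite_toSet _)).1 h1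
  obtain ⟨s, hs, hs'⟩ := U.nonempty_of_mem (Filter.inter_mem (hU.idem _ hr) hr)
  obtain ⟨t, ht, ht'⟩ := U.nonempty_of_mem (Filter.inter_mem hs hr)
  have h2 : (s + t) % N = r := ht
  have h3 : s % N = r := hs'
  have h4 : t % N = r := ht'
  have hr0 : r = 0 := by
    have h5 : (s + t) % N = (s + 0) % N := by rw [h2, Nat.add_zero, h3]
    have h6 : t ≡ 0 [MOD N] := Nat.ModEq.add_left_cancel' s h5
    rw [← h4, h6, Nat.zero_mod]
  filter_upwards [hr] with n hn
  exact Nat.dvd_of_mod_eq_zero (hn.trans hr0)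

/-- `x` is strictly increasing, and all finite sums of terms from the `n`-th on lie in the set that
`S` assigns to the first `n` terms. -/
structure IsAdapted (S : ℕ → Finset ℕ → Set ℕ) (x : ℕ → ℕ) : Prop where
  strictMono : StrictMono x
  sum_mem : ∀ (n : ℕ) (α : Finset ℕ), α.Nonempty → (∀ i ∈ α, n ≤ i) →
    ∑ i ∈ α, x i ∈ S n ((Finset.range n).image x)

theorem IsAdapted.mono {S T : ℕ → Finset ℕ → Set ℕ} {x : ℕ → ℕ} (hx : IsAdapted S x)
    (h : ∀ n k, S n k ⊆ T n k) : IsAdapted T x :=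
  ⟨hx.strictMono, fun n α h1 h2 => h _ _ (hx.sum_mem n α h1 h2)⟩

theorem image_range_subset (x : ℕ → ℕ) {n m : ℕ} (h : n ≤ m) :
    (Finset.range n).image x ⊆ (Finset.range m).image x :=
  Finset.image_subset_image (Finset.range_mono h)

/-- The Galvin–Glazer argument: for `s ∈ star X`, almost every `t` has `s + t ∈ star X`, so a sum in
`star X` can always be prolonged. -/
theorem IsSumIdempotent.exists_isAdapted {U : Ultrafilter ℕ} (hU : IsSumIdempotent U)
    (S : ℕ → Finset ℕ → Set ℕ) (hS : ∀ n h, S n h ∈ U) : ∃ x, IsAdapted S x := by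
  let star : Set ℕ → Set ℕ := fun X => {s | s ∈ X ∧ {t | s + t ∈ X} ∈ U}
  have hstar : ∀ X ∈ U, star X ∈ U := fun X hX => Filter.inter_mem hX (hU.idem X hX)
  have hshift : ∀ X, ∀ s ∈ star X, {t | s + t ∈ star X} ∈ U := by
    intro X s hs
    filter_upwards [hstar _ hs.2] with t ht
    refine ⟨ht.1, ?_⟩
    filter_upwards [ht.2] with u hu
    rw [add_assoc]
    exact hu
  obtain ⟨x, hx, hxS⟩ := exists_strictMono_mem hU.le_cofinite
    -- A new term must serve every earlier history and every partial sum; both range over subsets of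
    -- the current history.
    (fun n h => {m | ∀ j ∈ Finset.range (n + 1), ∀ h' ∈ h.powerset, ∀ β ∈ h.powerset,
      {t | ∑ i ∈ β, i + t ∈ star (S j h')} ∈ U → m ∈ {t | ∑ i ∈ β, i + t ∈ star (S j h')}})
    (fun n h => (Filter.eventually_all_finset _).2 fun j _ =>
      (Filter.eventually_all_finset _).2 fun h' _ => (Filter.eventually_all_finset _).2
        fun β _ => eventually_mem_of_mem U _)
  refine ⟨x, hx, fun n α => ?_⟩
  suffices h : α.Nonempty → (∀ i ∈ α, n ≤ i) →
      ∑ i ∈ α, x i ∈ star (S n ((Finset.range n).image x)) from fun h1 h2 => (h h1 h2).1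
  induction α using Finset.induction_on_max with
  | empty => intro h; exact absurd h Finset.not_nonempty_empty
  | insert b α hb ih =>
    intro _ hn
    have hnb : n ≤ b := hn b (Finset.mem_insert_self _ _)
    have hsub : α.image x ∈ ((Finset.range b).image x).powerset :=
      Finset.mem_powerset.2 (Finset.image_subset_image fun i hi => Finset.mem_range.2 (hb i hi))
    have hsum : ∑ i ∈ α.image x, i = ∑ i ∈ α, x i := Finset.sum_image hx.injective.injOn
    have hmem := hxS b n (Finset.mem_range.2 (by omega)) _
      (Finset.mem_powerset.2 (image_range_subset x hnb)) _ hsub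
    rw [Finset.sum_insert (fun h => (hb b h).false), add_comm, ← hsum]
    refine hmem ?_
    rw [hsum]
    rcases α.eq_empty_or_nonempty with rfl | hα
    · simpa using hstar _ (hS _ _)
    · exact hshift _ _ (ih hα fun i hi => hn i (Finset.mem_insert_of_mem hi))

theorem exists_finset_of_mem_finiteSums {x : ℕ → ℕ} (hx : Function.Injective x) {F : Set ℕ}
    (hF : F ⊆ Set.range x) {m : ℕ} (hm : m ∈ finiteSums F) :
    ∃ α : Finset ℕ, α.Nonempty ∧ (∀ i ∈ α, x i ∈ F) ∧ m = ∑ i ∈ α, x i := by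
  obtain ⟨β, hβ, hβF, rfl⟩ := hm
  obtain ⟨α, -, rfl⟩ : ∃ α : Finset ℕ, (α : Set ℕ) ⊆ Set.univ ∧ α.image x = β := by
    rw [← Finset.subset_set_image_iff, Set.image_univ]
    exact hβF.trans hF
  refine ⟨α, Finset.image_nonempty.1 hβ, fun i hi => hβF ?_, Finset.sum_image hx.injOn⟩
  exact Finset.mem_coe.2 (Finset.mem_image_of_mem x hi)

theorem isRich_finiteSums : IsRich finiteSums where
  mono _ _ := finiteSums_mono
  infinite F hF := hF.mono (subset_finiteSums F)
  exists_point F hF := by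
    obtain ⟨U, hU, hFU⟩ := exists_isSumIdempotent_mem hF
    refine ⟨U, hFU, fun 𝒟 h𝒟 hmem => ?_⟩
    obtain ⟨A, hA⟩ := (h𝒟.insert Set.univ).exists_eq_range (Set.insert_nonempty _ _)
    have hAm : ∀ n, A n ∈ U := by
      intro n
      have h1 : A n ∈ insert Set.univ 𝒟 := hA ▸ Set.mem_range_self n
      rcases h1 with h | h
      · rw [h]; exact Filter.univ_mem
      · exact hmem _ h
    obtain ⟨x, hx⟩ := hU.exists_isAdapted (fun n _ => A n) fun n _ => hAm n
    have hinj := hx.strictMono.injective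
    refine ⟨Set.range x, Set.infinite_range_of_injective hinj, fun D hD => ?_⟩
    obtain ⟨n, rfl⟩ : D ∈ Set.range A := hA ▸ Or.inr hD
    refine ⟨(Finset.range n).image x, fun m hm => ?_⟩
    obtain ⟨α, hα, hαn, rfl⟩ := exists_finset_of_mem_finiteSums hinj Set.sdiff_subset hm
    exact hx.sum_mem n α hα fun i hi => not_lt_of_notMem_image (hαn i hi).2

/-- Every infinite set has a sum subsystem whose binary supports are separated. -/
theorem exists_separated_subsystem {E : Set ℕ} (hE : E.Infinite) :
    ∃ e : ℕ → ℕ, StrictMono e ∧ (∀ i, 0 < e i) ∧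
      (∀ i j, i < j → 2 ^ (Nat.log 2 (e i) + 1) ∣ e j) ∧
      ∀ α : Finset ℕ, α.Nonempty → ∑ i ∈ α, e i ∈ finiteSums E := by
  obtain ⟨U, hU, hEU⟩ := exists_isSumIdempotent_mem hE
  have hpos : {m : ℕ | 0 < m} ∈ U := hU.le_cofinite
    ((Set.finite_le_nat 0).subset fun m hm => by simpa using hm)
  obtain ⟨x, hx⟩ := hU.exists_isAdapted
    (fun _ h => {m | (m ∈ finiteSums E ∧ 0 < m) ∧ ∀ k ∈ h, 2 ^ (Nat.log 2 k + 1) ∣ m})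
    fun _ h => Filter.inter_mem (Filter.inter_mem hEU hpos)
      ((Filter.eventually_all_finset h).2 fun k _ => hU.dvd_mem (by positivity))
  have hone : ∀ i, x i ∈ _ := fun i => by
    have h := hx.sum_mem i {i} (Finset.singleton_nonempty i) (by simp)
    rwa [Finset.sum_singleton] at h
  refine ⟨x, hx.strictMono, fun i => (hone i).1.2, fun i j hij => ?_, fun α hα =>
    (hx.sum_mem 0 α hα fun i _ => Nat.zero_le i).1.1⟩
  exact (hone j).2 _ (Finset.mem_image_of_mem x (Finset.mem_range.2 hij))

/-- The support of `e` lies above that of `a`, so the lowest digit of the sum is that of `a`. -/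
theorem padicValNat_two_add_of_dvd {a e : ℕ} (ha : 0 < a) (h : 2 ^ (Nat.log 2 a + 1) ∣ e) :
    padicValNat 2 (a + e) = padicValNat 2 a := by
  have hlt : a < 2 ^ (Nat.log 2 a + 1) := Nat.lt_pow_succ_log_self one_lt_two a
  have key : ∀ k, 2 ^ k ∣ a + e ↔ 2 ^ k ∣ a := by
    intro k
    rcases le_or_gt k (Nat.log 2 a + 1) with hk | hk
    · exact (Nat.dvd_add_left ((pow_dvd_pow 2 hk).trans h))
    · have h1 : ¬ 2 ^ (Nat.log 2 a + 1) ∣ a := fun h' => (Nat.le_of_dvd ha h').not_gt hlt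
      constructor
      · intro h2
        exact absurd ((Nat.dvd_add_left h).1 ((pow_dvd_pow 2 hk.le).trans h2)) h1
      · intro h2
        exact absurd ((pow_dvd_pow 2 hk.le).trans h2) h1
  refine le_antisymm ?_ ?_
  · rw [← padicValNat_dvd_iff_le ha.ne', ← key]
    exact pow_padicValNat_dvd
  · rw [← padicValNat_dvd_iff_le (by omega), key]
    exact pow_padicValNat_dvd

theorem log_two_add_of_dvd {a e : ℕ} (he : 0 < e) (h : 2 ^ (Nat.log 2 a + 1) ∣ e) :
    Nat.log 2 (a + e) = Nat.log 2 e := by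
  have hlt : a < 2 ^ (Nat.log 2 a + 1) := Nat.lt_pow_succ_log_self one_lt_two a
  have h1 : 2 ^ (Nat.log 2 a + 1) ≤ e := Nat.le_of_dvd he h
  have h2 : Nat.log 2 a + 1 ≤ Nat.log 2 e := Nat.le_log_of_pow_le one_lt_two h1
  rw [Nat.log_eq_iff (Or.inr ⟨one_lt_two, by omega⟩)]
  refine ⟨(Nat.pow_log_le_self 2 he.ne').trans (by omega), ?_⟩
  obtain ⟨q, rfl⟩ := h
  have h3 : 2 ^ (Nat.log 2 a + 1) * q < 2 ^ (Nat.log 2 (2 ^ (Nat.log 2 a + 1) * q) + 1) :=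
    Nat.lt_pow_succ_log_self one_lt_two _
  obtain ⟨d, hd⟩ := Nat.exists_eq_add_of_le h2
  rw [hd, add_assoc, pow_add 2 (Nat.log 2 a + 1)] at h3 ⊢
  have h4 := lt_of_mul_lt_mul_left h3 (Nat.zero_le _)
  calc a + 2 ^ (Nat.log 2 a + 1) * q < 2 ^ (Nat.log 2 a + 1) * (q + 1) := by
        rw [mul_add, mul_one]; omega
    _ ≤ _ := Nat.mul_le_mul_left _ h4

end Sums

/-! ## Images of `[F]²` contain no sets of finite sums -/

section PairsToSums

/-- Both the 2-adic valuation and the binary logarithm of `g` are made canonical. Among separated `e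
i`, the valuation is not constant. If it determines the smaller index, all sums starting with `e 0`
share that index. A logarithm depending on this index cannot separate `e 0 + e 1` from `e 0 + e 2`,
and one determining the larger index gives `e 0 + e 2` and `e 0 + e 1 + e 2` the same pair. -/
theorem exists_rhoSmall_finiteSums_image_pairsOf (g : NatPair → ℕ) :
    ∃ F : Set ℕ, F.Infinite ∧ RhoSmall finiteSums (g '' pairsOf F) := by
  obtain ⟨U, hU, -⟩ := exists_ultrafilter_mem_of_infinite Set.infinite_univ
  obtain ⟨S₁, hS₁, h₁⟩ := exists_pair_canonical U fun k m => padicValNat 2 (g (natPair k m))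
  obtain ⟨S₂, hS₂, h₂⟩ := exists_pair_canonical U fun k m => Nat.log 2 (g (natPair k m))
  obtain ⟨x, hx, hxS⟩ := exists_strictMono_mem hU (fun n h => S₁ n h ∩ S₂ n h)
    fun n h => Filter.inter_mem (hS₁ n h) (hS₂ n h)
  refine ⟨Set.range x, Set.infinite_range_of_injective hx.injective, fun E hE hsub => ?_⟩
  obtain ⟨e, he, hpos, hdvd, hsum⟩ := exists_separated_subsystem hE
  have hrep : ∀ s ∈ finiteSums E, ∃ i j, i < j ∧ s = g (natPair (x i) (x j)) := by
    intro s hs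
    obtain ⟨p, hp, rfl⟩ := hsub hs
    obtain ⟨i, j, hij, -, -, rfl⟩ := exists_of_mem_pairsOf_range hx subset_rfl hp
    exact ⟨i, j, hij, rfl⟩
  have hsum1 : ∀ k, e k ∈ finiteSums E := fun k => by
    simpa using hsum {k} (Finset.singleton_nonempty k)
  have hsum2 : ∀ k, 0 < k → e 0 + e k ∈ finiteSums E := fun k hk => by
    have := hsum {0, k} (Finset.insert_nonempty _ _)
    rwa [Finset.sum_pair hk.ne] at this
  have hsum3 : e 0 + (e 1 + e 2) ∈ finiteSums E := by
    have := hsum {0, 1, 2} (Finset.insert_nonempty _ _)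
    simpa using this
  have hbot : ∀ k, 0 < k → padicValNat 2 (e 0 + e k) = padicValNat 2 (e 0) := fun k hk =>
    padicValNat_two_add_of_dvd (hpos 0) (hdvd 0 k hk)
  have htop : ∀ i j, i < j → Nat.log 2 (e i + e j) = Nat.log 2 (e j) := fun i j hij =>
    log_two_add_of_dvd (hpos j) (hdvd i j hij)
  have hlog : ∀ i j, i < j → Nat.log 2 (e i) < Nat.log 2 (e j) := fun i j hij =>
    Nat.le_log_of_pow_le one_lt_two (Nat.le_of_dvd (hpos j) (hdvd i j hij))
  rcases h₁ x fun n => (hxS n).1 with ⟨L₁, hL₁, hL₁' | hL₁'⟩ | hmax₁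
  · obtain ⟨i, j, hij, h0⟩ := hrep _ (hsum1 0)
    obtain ⟨i', j', hij', h1⟩ := hrep _ (hsum1 1)
    have h2 := hL₁ i j hij
    have h3 := hL₁ i' j' hij'
    rw [← h0] at h2
    rw [← h1] at h3
    have h4 : padicValNat 2 (e 1) = padicValNat 2 (e 0) := by rw [h2, h3, hL₁' i' i]
    have h5 : 2 ^ (Nat.log 2 (e 0) + 1) ∣ e 0 := by
      rw [padicValNat_dvd_iff_le (hpos 0).ne', ← h4, ← padicValNat_dvd_iff_le (hpos 1).ne']
      exact hdvd 0 1 one_pos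
    exact (Nat.le_of_dvd (hpos 0) h5).not_gt (Nat.lt_pow_succ_log_self one_lt_two _)
  · rcases h₂ x fun n => (hxS n).2 with ⟨L₂, hL₂, -⟩ | hmax₂
    · obtain ⟨i, j, hij, h1⟩ := hrep _ (hsum2 1 one_pos)
      obtain ⟨i', j', hij', h2⟩ := hrep _ (hsum2 2 two_pos)
      have h3 : i = i' := hL₁' (by
        rw [← hL₁ i j hij, ← hL₁ i' j' hij', ← h1, ← h2, hbot 1 one_pos, hbot 2 two_pos])
      have h4 : Nat.log 2 (e 0 + e 1) = Nat.log 2 (e 0 + e 2) := by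
        have h5 := hL₂ i j hij
        have h6 := hL₂ i' j' hij'
        rw [← h1] at h5
        rw [← h2] at h6
        rw [h5, h6, h3]
      rw [htop 0 1 one_pos, htop 0 2 two_pos] at h4
      exact (hlog 1 2 one_lt_two).ne h4
    · obtain ⟨i, j, hij, h1⟩ := hrep _ (hsum2 2 two_pos)
      obtain ⟨i', j', hij', h2⟩ := hrep _ hsum3
      have hd : 2 ^ (Nat.log 2 (e 0) + 1) ∣ e 1 + e 2 :=
        dvd_add (hdvd 0 1 one_pos) (hdvd 0 2 two_pos)
      have h3 : i = i' := hL₁' (by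
        rw [← hL₁ i j hij, ← hL₁ i' j' hij', ← h1, ← h2, hbot 2 two_pos,
          padicValNat_two_add_of_dvd (hpos 0) hd])
      have h4 : j = j' := hmax₂ i j i' j' hij hij' (by
        rw [← h1, ← h2, htop 0 2 two_pos,
          log_two_add_of_dvd (Nat.add_pos_left (hpos 1) _) hd, htop 1 2 one_lt_two])
      rw [h3, h4, ← h2] at h1
      have := hpos 1
      omega
  -- If the valuation determines the larger index, all `e 0 + e (k + 1)` share it, leaving finitely
  -- many smaller indices for infinitely many sums.
  · choose! I J hIJ hg using hrep
    have hJ : ∀ k, J (e 0 + e (k + 1)) = J (e 0 + e 1) := fun k => by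
      refine hmax₁ _ _ _ _ (hIJ _ (hsum2 _ k.succ_pos)) (hIJ _ (hsum2 1 one_pos)) ?_
      rw [← hg _ (hsum2 _ k.succ_pos), ← hg _ (hsum2 1 one_pos), hbot _ k.succ_pos,
        hbot 1 one_pos]
    obtain ⟨k, l, hkl, hkl'⟩ := Finite.exists_ne_map_eq_of_infinite
      fun k : ℕ => (⟨I (e 0 + e (k + 1)), (hIJ _ (hsum2 _ k.succ_pos)).trans_eq (hJ k)⟩ :
        Fin (J (e 0 + e 1)))
    have h1 : I (e 0 + e (k + 1)) = I (e 0 + e (l + 1)) := congrArg Fin.val hkl'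
    have h2 : e 0 + e (k + 1) = e 0 + e (l + 1) := by
      rw [hg _ (hsum2 _ k.succ_pos), hg _ (hsum2 _ l.succ_pos), hJ k, hJ l, h1]
    have h3 := he.injective (Nat.add_left_cancel h2)
    omega

end PairsToSums

/-! ## Images of sets of finite sums contain no `[E]²` -/

section SumsToPairs

theorem IsAdapted.sum_image_mem {S : ℕ → Finset ℕ → Set ℕ} {x : ℕ → ℕ} (hx : IsAdapted S x)
    {n : ℕ} {α : Finset ℕ} (h : ∀ i ∈ α, i < n) :
    α.image x ∈ ((Finset.range n).image x).powerset ∧ ∑ i ∈ α.image x, i = ∑ i ∈ α, x i :=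
  ⟨Finset.mem_powerset.2 (Finset.image_subset_image fun i hi => Finset.mem_range.2 (h i hi)),
    Finset.sum_image hx.strictMono.injective.injOn⟩

/-- If `f(s + t)` is almost always a function of `s`, then `f` of a sum is a function of its
least term. -/
theorem exists_adapted_eq_of_min {U : Ultrafilter ℕ} (f P : ℕ → ℕ)
    (h : ∀ᶠ s in U, ∀ᶠ t in U, f (s + t) = P s) :
    ∃ S : ℕ → Finset ℕ → Set ℕ, (∀ n h, S n h ∈ U) ∧ ∀ x, IsAdapted S x →
      ∀ α : Finset ℕ, 2 ≤ α.card → ∀ i ∈ α, (∀ j ∈ α, i ≤ j) → f (∑ l ∈ α, x l) = P (x i) := by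
  refine ⟨fun n H => {m | (∀ᶠ t in U, f (m + t) = P m) ∧ ∀ k ∈ H,
    {t | f (k + t) = P k} ∈ U → m ∈ {t | f (k + t) = P k}},
    fun n H => ?_, fun x hx α hα i hi hmin => ?_⟩
  · exact h.and ((Filter.eventually_all_finset _).2 fun k _ => eventually_mem_of_mem U _)
  · have h1 : ∀ᶠ t in U, f (x i + t) = P (x i) := by
      have := (hx.sum_mem 0 {i} (Finset.singleton_nonempty i) (by simp)).1
      simpa using this
    have hne : (α.erase i).Nonempty := by
      rw [← Finset.card_pos, Finset.card_erase_of_mem hi]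
      omega
    have h2 := (hx.sum_mem (i + 1) (α.erase i) hne fun j hj =>
      lt_of_le_of_ne (hmin j (Finset.mem_of_mem_erase hj)) (Finset.ne_of_mem_erase hj).symm).2
      (x i) (Finset.mem_image_of_mem x (by simp)) h1
    rw [← Finset.add_sum_erase α x hi]
    exact h2

/-- If `f(s + t)` tends to infinity for almost all `s`, then `f` of a sum determines its greatest
term, and avoids prescribed values attached to the smaller terms. -/
theorem exists_adapted_max_eq {U : Ultrafilter ℕ} (f R : ℕ → ℕ)
    (h : ∀ᶠ s in U, ∀ v, ∀ᶠ t in U, f (s + t) ≠ v) :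
    ∃ S : ℕ → Finset ℕ → Set ℕ, (∀ n h, S n h ∈ U) ∧ ∀ x, IsAdapted S x →
      ∀ α : Finset ℕ, 2 ≤ α.card → ∀ j ∈ α, (∀ i ∈ α, i ≤ j) →
        (∀ β : Finset ℕ, (∀ i ∈ β, i < j) → f (∑ l ∈ α, x l) ≠ f (∑ l ∈ β, x l)) ∧
        ∀ i < j, f (∑ l ∈ α, x l) ≠ R (x i) := by
  refine ⟨fun n H => {m | (∀ v, ∀ᶠ t in U, f (m + t) ≠ v) ∧ ∀ γ ∈ H.powerset,
    (∀ β ∈ H.powerset, {t | f (∑ i ∈ γ, i + t) ≠ f (∑ i ∈ β, i)} ∈ U →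
      m ∈ {t | f (∑ i ∈ γ, i + t) ≠ f (∑ i ∈ β, i)}) ∧
    ∀ k ∈ H, {t | f (∑ i ∈ γ, i + t) ≠ R k} ∈ U → m ∈ {t | f (∑ i ∈ γ, i + t) ≠ R k}},
    fun n H => ?_, fun x hx α hα j hj hmax => ?_⟩
  · exact h.and ((Filter.eventually_all_finset _).2 fun γ _ =>
      Filter.Eventually.and
        ((Filter.eventually_all_finset _).2 fun β _ => eventually_mem_of_mem U _)
        ((Filter.eventually_all_finset _).2 fun k _ => eventually_mem_of_mem U _))
  · have hne : (α.erase j).Nonempty := by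
      rw [← Finset.card_pos, Finset.card_erase_of_mem hj]
      omega
    have hlt : ∀ i ∈ α.erase j, i < j := fun i hi =>
      lt_of_le_of_ne (hmax i (Finset.mem_of_mem_erase hi)) (Finset.ne_of_mem_erase hi)
    have h1 := (hx.sum_mem 0 (α.erase j) hne fun i _ => Nat.zero_le i).1
    have h2 := (hx.sum_mem j {j} (Finset.singleton_nonempty j) (by simp)).2
    obtain ⟨hγ, hγs⟩ := hx.sum_image_mem hlt
    have h3 := h2 _ hγ
    rw [hγs, Finset.sum_singleton] at h3
    rw [← Finset.sum_erase_add α x hj]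
    refine ⟨fun β hβ => ?_, fun i hi => ?_⟩
    · obtain ⟨hβ', hβs⟩ := hx.sum_image_mem hβ
      have h4 := h3.1 _ hβ'
      rw [hβs] at h4
      exact h4 (h1 _)
    · exact h3.2 _ (Finset.mem_image_of_mem x (Finset.mem_range.2 hi)) (h1 _)

/-- Each value of `P` is taken on a null set, so a new term can dodge the finitely many values
attached to earlier terms and their sums. -/
theorem exists_adapted_injective {U : Ultrafilter ℕ} (P R : ℕ → ℕ)
    (h : ∀ v, ∀ᶠ s in U, P s ≠ v) :
    ∃ S : ℕ → Finset ℕ → Set ℕ, (∀ n h, S n h ∈ U) ∧ ∀ x, IsAdapted S x →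
      Function.Injective (fun i => P (x i)) ∧
      ∀ i, ∀ β : Finset ℕ, (∀ j ∈ β, j < i) → P (x i) ≠ R (∑ l ∈ β, x l) := by
  refine ⟨fun n H => {m | (∀ k ∈ H, P m ≠ P k) ∧ ∀ β ∈ H.powerset, P m ≠ R (∑ i ∈ β, i)},
    fun n H => ?_, fun x hx => ?_⟩
  · exact Filter.Eventually.and ((Filter.eventually_all_finset _).2 fun k _ => h _)
      ((Filter.eventually_all_finset _).2 fun β _ => h _)
  · have hone : ∀ i, x i ∈ _ := fun i => by
      have h := hx.sum_mem i {i} (Finset.singleton_nonempty i) (by simp)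
      rwa [Finset.sum_singleton] at h
    have hne : ∀ i j, i < j → P (x j) ≠ P (x i) := fun i j hij =>
      (hone j).1 _ (Finset.mem_image_of_mem x (Finset.mem_range.2 hij))
    refine ⟨fun i j hij => ?_, fun i β hβ => ?_⟩
    · rcases lt_trichotomy i j with h | h | h
      · exact absurd hij.symm (hne i j h)
      · exact h
      · exact absurd hij (hne j i h)
    · obtain ⟨h1, h2⟩ := hx.sum_image_mem hβ
      have h3 := (hone i).2 _ h1
      rwa [h2] at h3

theorem exists_limit_function (U : Ultrafilter ℕ) (f : ℕ → ℕ) :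
    (∀ᶠ s in U, ∀ v, ∀ᶠ t in U, f (s + t) ≠ v) ∨
      ∃ P : ℕ → ℕ, ∀ᶠ s in U, ∀ᶠ t in U, f (s + t) = P s := by
  classical
  by_cases hB : ∀ᶠ s in U, ∀ v, ∀ᶠ t in U, f (s + t) ≠ v
  · exact Or.inl hB
  · have hA : ∀ᶠ s in U, ∃ v, ∀ᶠ t in U, f (s + t) = v := by
      filter_upwards [Ultrafilter.eventually_not.2 hB] with k hk
      push Not at hk
      exact hk
    refine Or.inr ⟨fun s => if h : ∃ v, ∀ᶠ t in U, f (s + t) = v then h.choose else 0, ?_⟩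
    filter_upwards [hA] with k hk
    simp only [hk, dif_pos]
    exact hk.choose_spec

/-- Finite sums of the consecutive blocks `x₂ₙ + x₂ₙ₊₁`. -/
theorem exists_of_mem_finiteSums_blocks {x : ℕ → ℕ} (hx : StrictMono x) {m : ℕ}
    (hm : m ∈ finiteSums (Set.range fun n => x (2 * n) + x (2 * n + 1))) :
    ∃ α : Finset ℕ, 2 ≤ α.card ∧ (∃ i ∈ α, Even i ∧ ∀ l ∈ α, i ≤ l) ∧
      (∃ j ∈ α, Odd j ∧ ∀ l ∈ α, l ≤ j) ∧ m = ∑ l ∈ α, x l := by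
  have hy : StrictMono fun n => x (2 * n) + x (2 * n + 1) := fun a b hab =>
    add_lt_add (hx (by omega)) (hx (by omega))
  obtain ⟨β, hβ, -, rfl⟩ := exists_finset_of_mem_finiteSums hy.injective subset_rfl hm
  have hmem : ∀ l, l ∈ β.biUnion (fun n => {2 * n, 2 * n + 1}) ↔ l / 2 ∈ β := by
    intro l
    simp only [Finset.mem_biUnion, Finset.mem_insert, Finset.mem_singleton]
    constructor
    · rintro ⟨n, hn, rfl | rfl⟩
      · rwa [Nat.mul_div_cancel_left n two_pos]
      · rwa [show (2 * n + 1) / 2 = n by omega]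
    · intro h
      exact ⟨_, h, by omega⟩
  refine ⟨β.biUnion fun n => {2 * n, 2 * n + 1}, ?_, ?_, ?_, ?_⟩
  · obtain ⟨n, hn⟩ := hβ
    have h := Finset.card_le_card
      (Finset.subset_biUnion_of_mem (fun n => ({2 * n, 2 * n + 1} : Finset ℕ)) hn)
    rwa [Finset.card_pair (by omega)] at h
  · refine ⟨2 * β.min' hβ, ?_, even_two_mul _, fun l hl => ?_⟩
    · rw [hmem, Nat.mul_div_cancel_left _ two_pos]
      exact β.min'_mem hβ
    · have := β.min'_le _ ((hmem l).1 hl)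
      omega
  · refine ⟨2 * β.max' hβ + 1, ?_, odd_two_mul_add_one _, fun l hl => ?_⟩
    · rw [hmem, show (2 * β.max' hβ + 1) / 2 = β.max' hβ by omega]
      exact β.max'_mem hβ
    · have := β.le_max' _ ((hmem l).1 hl)
      omega
  · rw [Finset.sum_biUnion]
    · exact Finset.sum_congr rfl fun n _ => (Finset.sum_pair (by omega)).symm
    · intro a _ b _ hab
      change Disjoint ({2 * a, 2 * a + 1} : Finset ℕ) {2 * b, 2 * b + 1}
      rw [Finset.disjoint_left]
      intro l h1 h2
      simp only [Finset.mem_insert, Finset.mem_singleton] at h1 h2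
      omega

/-- The smaller and larger entries `p`, `q` of `g` are each governed either by the least summand or
by the greatest. Summing in blocks of two gives every sum at least two terms, an even least index
and an odd greatest one. -/
theorem exists_rhoSmall_pairsOf_image_finiteSums (g : ℕ → NatPair) :
    ∃ F : Set ℕ, F.Infinite ∧ RhoSmall pairsOf (g '' finiteSums F) := by
  obtain ⟨U, hU, -⟩ := exists_isSumIdempotent_mem Set.infinite_univ
  choose p q hpq hg using fun n => exists_eq_natPair (g n)
  have hF : ∀ x : ℕ → ℕ, StrictMono x →
      (Set.range fun n => x (2 * n) + x (2 * n + 1)).Infinite := fun x hx =>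
    Set.infinite_range_of_injective (StrictMono.injective fun a b hab =>
      add_lt_add (hx (by omega)) (hx (by omega)))
  -- a pair from `E` is represented by a finite set of indices with even minimum and odd maximum
  have hrep : ∀ (x : ℕ → ℕ), StrictMono x → ∀ E : Set ℕ,
      pairsOf E ⊆ g '' finiteSums (Set.range fun n => x (2 * n) + x (2 * n + 1)) →
      ∀ a ∈ E, ∀ b ∈ E, a < b → ∃ α : Finset ℕ, 2 ≤ α.card ∧
        (∃ i ∈ α, Even i ∧ ∀ l ∈ α, i ≤ l) ∧ (∃ j ∈ α, Odd j ∧ ∀ l ∈ α, l ≤ j) ∧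
        p (∑ l ∈ α, x l) = a ∧ q (∑ l ∈ α, x l) = b := by
    intro x hx E hE a ha b hb hab
    obtain ⟨m, hm, hgm⟩ := hE ((natPair_mem_pairsOf hab).2 ⟨ha, hb⟩)
    obtain ⟨α, h1, h2, h3, rfl⟩ := exists_of_mem_finiteSums_blocks hx hm
    rw [hg] at hgm
    obtain ⟨h4, h5⟩ := natPair_inj (hpq _) hab hgm
    exact ⟨α, h1, h2, h3, h4, h5⟩
  rcases exists_limit_function U p with hp | ⟨P, hP⟩
  -- Only avoidance of earlier values of `p` is needed, so `id` is an arbitrary choice.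
  · obtain ⟨S, hS, hSx⟩ := exists_adapted_max_eq p id hp
    obtain ⟨x, hx⟩ := hU.exists_isAdapted S hS
    refine ⟨_, hF x hx.strictMono, fun E hE hsub => ?_⟩
    obtain ⟨a, ha⟩ := hE.nonempty
    choose! α h2 hmin hmax hpα hqα using hrep x hx.strictMono E hsub a ha
    obtain ⟨b₀, hb₀, hab₀⟩ := hE.exists_gt a
    obtain ⟨J, hJ, -, hJmax⟩ := hmax b₀ hb₀ hab₀
    have hEa : (E \ {b | b ≤ a}).Infinite := hE.sdiff (Set.finite_le_nat a)
    -- With `a` fixed, greatest indices are bounded by `J`, so finitely many index sets would have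
    -- to represent infinitely many `b`.
    refine (hEa.image (f := α) ?_) ((Finset.range (J + 1)).powerset.finite_toSet.subset ?_)
    · rintro b ⟨hb, hab⟩ c ⟨hc, hac⟩ hbc
      rw [← hqα b hb (not_le.1 hab), ← hqα c hc (not_le.1 hac), hbc]
    · rintro _ ⟨b, ⟨hb, hab⟩, rfl⟩
      have hab : a < b := not_le.1 hab
      obtain ⟨j, hj, -, hjmax⟩ := hmax b hb hab
      rw [Finset.mem_coe, Finset.mem_powerset]
      intro l hl
      have hjJ : j ≤ J := by
        by_contra hlt
        refine (hSx x hx (α b) (h2 b hb hab) j hj hjmax).1 (α b₀) (fun i hi => ?_) ?_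
        · exact (hJmax i hi).trans_lt (not_le.1 hlt)
        · rw [hpα b hb hab, hpα b₀ hb₀ hab₀]
      exact Finset.mem_range.2 (Nat.lt_succ_of_le ((hjmax l hl).trans hjJ))
  obtain ⟨S₁, hS₁, h₁⟩ := exists_adapted_eq_of_min p P hP
  by_cases hc : ∃ v, ∀ᶠ s in U, P s = v
  · obtain ⟨v, hv⟩ := hc
    obtain ⟨x, hx⟩ := hU.exists_isAdapted (fun n h => S₁ n h ∩ {s | P s = v})
      fun n h => Filter.inter_mem (hS₁ n h) hv
    refine ⟨_, hF x hx.strictMono, fun E hE hsub => ?_⟩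
    have hpv : ∀ a ∈ E, a = v := by
      intro a ha
      obtain ⟨b, hb, hab⟩ := hE.exists_gt a
      obtain ⟨α, h2, ⟨i, hi, -, himin⟩, -, hpα, -⟩ := hrep x hx.strictMono E hsub a ha b hb hab
      rw [← hpα, h₁ x (hx.mono fun _ _ => Set.inter_subset_left) α h2 i hi himin]
      simpa using (hx.sum_mem 0 {i} (Finset.singleton_nonempty i) (by simp)).2
    exact hE ((Set.finite_singleton v).subset hpv)
  have hP' : ∀ v, ∀ᶠ s in U, P s ≠ v := fun v =>
    Ultrafilter.eventually_not.2 fun h => hc ⟨v, h⟩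
  obtain ⟨S₂, hS₂, h₂⟩ := exists_adapted_injective P q hP'
  rcases exists_limit_function U q with hq | ⟨Q, hQ⟩
  · obtain ⟨S₃, hS₃, h₃⟩ := exists_adapted_max_eq q P hq
    obtain ⟨x, hx⟩ := hU.exists_isAdapted (fun n h => S₁ n h ∩ S₂ n h ∩ S₃ n h)
      fun n h => Filter.inter_mem (Filter.inter_mem (hS₁ n h) (hS₂ n h)) (hS₃ n h)
    refine ⟨_, hF x hx.strictMono, fun E hE hsub => ?_⟩
    obtain ⟨a, ha⟩ := hE.nonempty
    obtain ⟨b, hb, hab⟩ := hE.exists_gt a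
    obtain ⟨c, hcE, hbc⟩ := hE.exists_gt b
    obtain ⟨α, h2, -, ⟨j, hj, hodd, hjmax⟩, -, hqα⟩ := hrep x hx.strictMono E hsub a ha b hb hab
    obtain ⟨β, h2', ⟨i, hi, heven, himin⟩, -, hpβ, -⟩ := hrep x hx.strictMono E hsub b hb c hcE hbc
    -- Here `b` is the larger entry for `α` and the smaller entry for `β`; parity excludes `i = j`,
    -- and the adapted conditions exclude both inequalities.
    rw [h₁ x (hx.mono fun _ _ _ h => h.1.1) β h2' i hi himin, ← hqα] at hpβ
    rcases lt_trichotomy i j with h | h | h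
    · exact (h₃ x (hx.mono fun _ _ _ h => h.2) α h2 j hj hjmax).2 i h hpβ.symm
    · exact Nat.not_even_iff_odd.2 hodd (h ▸ heven)
    · exact (h₂ x (hx.mono fun _ _ _ h => h.1.2)).2 i α
        (fun l hl => (hjmax l hl).trans_lt h) hpβ
  · obtain ⟨S₃, hS₃, h₃⟩ := exists_adapted_eq_of_min q Q hQ
    obtain ⟨x, hx⟩ := hU.exists_isAdapted (fun n h => S₁ n h ∩ S₂ n h ∩ S₃ n h)
      fun n h => Filter.inter_mem (Filter.inter_mem (hS₁ n h) (hS₂ n h)) (hS₃ n h)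
    refine ⟨_, hF x hx.strictMono, fun E hE hsub => ?_⟩
    obtain ⟨a, ha⟩ := hE.nonempty
    obtain ⟨b, hb, hab⟩ := hE.exists_gt a
    obtain ⟨c, hcE, hbc⟩ := hE.exists_gt b
    obtain ⟨α, h2, ⟨i, hi, -, himin⟩, -, hpα, hqα⟩ := hrep x hx.strictMono E hsub a ha b hb hab
    obtain ⟨β, h2', ⟨i', hi', -, himin'⟩, -, hpβ, hqβ⟩ :=
      hrep x hx.strictMono E hsub a ha c hcE (hab.trans hbc)
    have hx₁ := hx.mono fun _ _ _ h => h.1.1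
    have hx₃ := hx.mono fun _ _ _ h => h.2
    rw [h₁ x hx₁ α h2 i hi himin] at hpα
    rw [h₁ x hx₁ β h2' i' hi' himin'] at hpβ
    rw [h₃ x hx₃ α h2 i hi himin] at hqα
    rw [h₃ x hx₃ β h2' i' hi' himin'] at hqβ
    -- Both entries depend only on the least summand, which the common smaller entry `a` determines;
    -- this forces `b = c`.
    have hii : i = i' := (h₂ x (hx.mono fun _ _ _ h => h.1.2)).1 (hpα.trans hpβ.symm)
    rw [← hqα, ← hqβ, hii] at hbc
    exact hbc.false

end SumsToPairs

/-! ## Relations between the three classes -/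

section Relations

theorem IsRamseySpace.isDifferentiallyCompact {X : Type*} [TopologicalSpace X]
    (h : IsRamseySpace X) : IsDifferentiallyCompact X := by
  intro f
  choose k m hkm hp using exists_eq_natPair
  obtain ⟨F, hF, x, hx⟩ := h fun p => f (m p - k p)
  refine ⟨F, hF, x, fun U hU => ?_⟩
  obtain ⟨K, hK⟩ := hx U hU
  refine ⟨K, ?_⟩
  rintro _ ⟨_, ⟨a, ha, b, hb, hab, rfl⟩, rfl⟩
  obtain ⟨h1, h2⟩ := natPair_inj hab (hkm _) (hp (natPair b a))
  refine hK ⟨natPair b a, (natPair_mem_pairsOf hab).2 ⟨hb, ha⟩, ?_⟩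
  change f (m (natPair b a) - k (natPair b a)) = _
  rw [← h1, ← h2]

/-- Differences of partial sums of a sequence are sums over intervals of its terms. -/
theorem IsHindmanSpace.isDifferentiallyCompact {X : Type*} [TopologicalSpace X]
    (h : IsHindmanSpace X) : IsDifferentiallyCompact X := by
  intro f
  obtain ⟨F, hF, x, hx⟩ := h f
  have hF' : (F \ {0}).Infinite := hF.sdiff (Set.finite_singleton 0)
  have : Infinite (F \ {0} : Set ℕ) := hF'.to_subtype
  let j := Infinite.natEmbedding (F \ {0} : Set ℕ)
  have hj : Function.Injective fun n => (j n : ℕ) := Subtype.val_injective.comp j.injective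
  let s : ℕ → ℕ := fun n => ∑ i ∈ Finset.range n, (j i : ℕ)
  have hs : StrictMono s := strictMono_nat_of_lt_succ fun n => by
    change s n < ∑ i ∈ Finset.range (n + 1), (j i : ℕ)
    rw [Finset.sum_range_succ]
    exact Nat.lt_add_of_pos_right (Nat.pos_of_ne_zero (j n).2.2)
  refine ⟨Set.range s, Set.infinite_range_of_injective hs.injective, x, fun U hU => ?_⟩
  obtain ⟨K, hK⟩ := hx U hU
  obtain ⟨N, hN⟩ : ∃ N, ∀ n, N ≤ n → (j n : ℕ) ∉ K := by
    obtain ⟨N, hN⟩ := (K.finite_toSet.preimage hj.injOn).bddAbove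
    exact ⟨N + 1, fun n hn h => absurd (hN h) (by omega)⟩
  refine ⟨(Finset.range N).image s, ?_⟩
  rintro _ ⟨_, ⟨_, ⟨⟨a, rfl⟩, -⟩, _, ⟨⟨b, rfl⟩, hb⟩, hab, rfl⟩, rfl⟩
  have hbN := not_lt_of_notMem_image hb
  have hba : b < a := hs.lt_iff_lt.1 hab
  refine hK ⟨_, ⟨(Finset.Ico b a).image fun n => (j n : ℕ), ?_, ?_, ?_⟩, rfl⟩
  · exact (Finset.nonempty_Ico.2 hba).image _
  · intro y hy
    obtain ⟨i, hi, rfl⟩ := Finset.mem_image.1 (Finset.mem_coe.1 hy)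
    exact ⟨(j i).2.1, hN i (hbN.trans (Finset.mem_Ico.1 hi).1)⟩
  · rw [Finset.sum_image hj.injOn]
    have h1 := Finset.sum_range_add_sum_Ico (fun i => (j i : ℕ)) hba.le
    change s b + _ = s a at h1
    omega

/-- Transports pairs to `ℕ`, because `exists_isGoodFamily` needs `ρ₂` to take values in subsets of
`ℕ`. -/
theorem IsRich.image {Λ M : Type*} (e : Λ ≃ M) {ρ : Set ℕ → Set Λ} (hρ : IsRich ρ) :
    IsRich fun F => e '' ρ F where
  mono _ _ h := Set.image_mono (hρ.mono h)
  infinite F hF := (hρ.infinite F hF).image e.injective.injOn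
  exists_point F hF := by
    obtain ⟨𝒱, h1, h2⟩ := hρ.exists_point F hF
    refine ⟨𝒱.map e, Filter.image_mem_map h1, fun 𝒟 h𝒟 hmem => ?_⟩
    obtain ⟨G, hG, hGD⟩ := h2 ((fun D => e ⁻¹' D) '' 𝒟) (h𝒟.image _) (by
      rintro _ ⟨D, hD, rfl⟩
      exact hmem D hD)
    refine ⟨G, hG, fun D hD => ?_⟩
    obtain ⟨K, hK⟩ := hGD _ ⟨D, hD, rfl⟩
    exact ⟨K, Set.image_subset_iff.2 hK⟩

theorem FinBW.image {Λ M X : Type*} [TopologicalSpace X] (e : Λ ≃ M) {ρ : Set ℕ → Set Λ}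
    (h : FinBW ρ X) : FinBW (fun F => e '' ρ F) X := by
  intro f
  obtain ⟨F, hF, x, hx⟩ := h (f ∘ e)
  refine ⟨F, hF, x, fun U hU => ?_⟩
  obtain ⟨K, hK⟩ := hx U hU
  exact ⟨K, by rwa [← Set.image_comp]⟩

end Relations

theorem mainTheorem4 (CH : Cardinal.continuum.{0} = Cardinal.aleph.{0} 1) :
    (∃ 𝒜 : Set (Set ℕ), IsGoodFamily 𝒜 ∧
      IsRamseySpace (Phi 𝒜) ∧ ¬ IsHindmanSpace (Phi 𝒜)) ∧
    (∃ 𝒜 : Set (Set ℕ), IsGoodFamily 𝒜 ∧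
      IsHindmanSpace (Phi 𝒜) ∧ ¬ IsRamseySpace (Phi 𝒜)) ∧
    (∃ 𝒜 : Set (Set ℕ), IsGoodFamily 𝒜 ∧
      IsDifferentiallyCompact (Phi 𝒜) ∧ ¬ IsHindmanSpace (Phi 𝒜)) ∧
    (∃ 𝒜 : Set (Set ℕ), IsGoodFamily 𝒜 ∧
      IsDifferentiallyCompact (Phi 𝒜) ∧ ¬ IsRamseySpace (Phi 𝒜)) := by
  have hRamsey : ∃ 𝒜 : Set (Set ℕ), IsGoodFamily 𝒜 ∧
      IsRamseySpace (Phi 𝒜) ∧ ¬ IsHindmanSpace (Phi 𝒜) :=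
    exists_isGoodFamily CH isRich_pairsOf isRich_finiteSums exists_rhoSmall_finiteSums_image_pairsOf
  have hHindman : ∃ 𝒜 : Set (Set ℕ), IsGoodFamily 𝒜 ∧
      IsHindmanSpace (Phi 𝒜) ∧ ¬ IsRamseySpace (Phi 𝒜) := by
    have : Infinite NatPair := Set.infinite_univ_iff.1
      ((pairsOf_infinite Set.infinite_univ).mono (Set.subset_univ _))
    obtain ⟨_⟩ := nonempty_denumerable NatPair
    let e : NatPair ≃ ℕ := Denumerable.eqv NatPair
    obtain ⟨𝒜, h1, h2, h3⟩ := exists_isGoodFamily CH isRich_finiteSums (isRich_pairsOf.image e)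
      fun g => by
        obtain ⟨F, hF, hs⟩ := exists_rhoSmall_pairsOf_image_finiteSums fun n => e.symm (g n)
        refine ⟨F, hF, fun E hE hsub => hs E hE fun p hp => ?_⟩
        obtain ⟨n, hn, hnp⟩ := hsub ⟨p, hp, rfl⟩
        exact ⟨n, hn, (congrArg e.symm hnp).trans (e.symm_apply_apply p)⟩
    exact ⟨𝒜, h1, h2, fun h => h3 (FinBW.image e h)⟩
  obtain ⟨𝒜, h1, h2, h3⟩ := hRamsey
  obtain ⟨ℬ, h4, h5, h6⟩ := hHindman
  exact ⟨⟨𝒜, h1, h2, h3⟩, ⟨ℬ, h4, h5, h6⟩, ⟨𝒜, h1, h2.isDifferentiallyCompact, h3⟩,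
    ⟨ℬ, h4, h5.isDifferentiallyCompact, h6⟩⟩
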